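/- \textbf{Setup.} Let $n\in\mathbb N$. Let $x_0\sim\mathcal N(0,\sigma_{x_0}^2)$, $n_t\sim\mathcal N(0,\sigma_{n_t}^2)$ ($0\le t\le n-1$), $w_t\sim\mathcal N(0,\sigma_{w_t}^2)$ and $v_t\sim\mathcal N(0,\sigma_{v_t}^2)$ ($0\le t\le n$) be mutually independent random variables on a probability space, with all variances positive, and let $\beta_t,A_t\in\mathbb R$ be deterministic. The source is $x_{t+1}=\beta_tx_t+n_t$. A linear memoryless encoder sends $m_t=A_tx_t$. The decoder chooses deterministic combining parameters $\alpha_t\in[0,1]$ and receives $$r_t=\alpha_t(m_t+v_t)+(1-\alpha_t)(x_t+w_t),\qquad 0\le t\le n.$$ Write $r^t=(r_0,\dots,r_t)$ ($r^{-1}$ is empty) and $c_t=\alpha_tA_t+1-\alpha_t$. At stage $t$ the decoder also chooses a measurable estimator $\gamma_t$ of $x_t$ from $r^t$; its stage cost is $\mathbf E[(x_t-\gamma_t(r^t))^2]\in[0,\infty]$. Put $\hat x_{t|t-1}=\mathbf E[x_t\mid r^{t-1}]$, $\hat x_{t|t}=\mathbf E[x_t\mid r^t]$, $\Sigma_{t|t-1}=\mathbf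 E[(x_t-\hat x_{t|t-1})^2\mid r^{t-1}]$, $\Sigma_{t|t}=\mathbf E[(x_t-\hat x_{t|t})^2\mid r^t]$, and define the innovation $I_t=r_t-\mathbf E[r_t\mid r^{t-1}]$. A pair of sequences $(\alpha,\gamma)$ is \emph{forward optimal} if for every $t\le n$, $(\alpha_t,\gamma_t)$ minimizes the stage cost at $t$ over all $a\in[0,1]$ and all measurable estimators, with $\alpha_0,\dots,\alpha_{t-1}$ kept fixed. \textbf{Theorem.} (i) \emph{Kalman filter.} For every choice of $\alpha_0,\dots,\alpha_n\in[0,1]$, almost surely: $\Sigma_{t|t-1}$ and $\Sigma_{t|t}$ are constant and equal to their expectations, $\hat x_{0|-1}=0$, $\Sigma_{0|-1}=\sigma_{x_0}^2$, for $1\le t\le n$ $$\hat x_{t|t-1}=\beta_{t-1}\hat x_{t-1|t-1},\qquad \Sigma_{t|t-1}=\beta_{t-1}^2\Sigma_{t-1|t-1}+\sigma_{n_{t-1}}^2,$$ and for $0\le t\le n$ $$I_t=c_t(x_t-\hat x_{t|t-1})+(1-\alpha_t)w_t+\alpha_tv_t,\qquad \sigma_{I_t}^2:=\operatorname{Var}(I_t)=c_t^2\Sigma_{t|t-1}+(1-\alpha_t)^2\sigma_{w_t}^2+\alpha_t^2\sigma_{v_t}^2>0,$$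 $$\hat x_{t|t}=\hat x_{t|t-1}+K_tI_t=\hat x_{t|t-1}+K_t(r_t-c_t\hat x_{t|t-1}),\qquad K_t=\frac{\Sigma_{t|t-1}c_t}{\sigma_{I_t}^2},\qquad \Sigma_{t|t}=(1-K_tc_t)\Sigma_{t|t-1}.$$ Among all measurable estimators of $x_t$ from $r^t$, $\hat x_{t|t}$ has the least stage cost, namely $\Sigma_{t|t}$, and it is the only minimizer up to almost sure equality. (ii) \emph{Optimal combining.} Call $(\alpha,K^*,J^{d,*},\Sigma^*)$ a \emph{solution of the table} if $\Sigma^*_{0|-1}=\sigma_{x_0}^2$, $\Sigma^*_{t+1|t}=\beta_t^2J_t^{d,*}+\sigma_{n_t}^2$ for $t<n$, and for each $t\le n$ one of the following rows holds (with $\Sigma=\Sigma^*_{t|t-1}$, $A=A_t$, $w=\sigma_{w_t}^2$, $v=\sigma_{v_t}^2$): $$\begin{array}{c|c|c|c}\text{case}&\alpha_t&K_t^*&J_t^{d,*}\\\hline A\ge0&\frac{Aw}{Aw+v}&\frac{A\Sigma w+\Sigma v}{A^2\Sigma w+\Sigma v+wv}&\frac{\Sigma wv}{(A^2w+v)\Sigma+wv}\\[4pt]-\sqrt{v/w}\le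 A\le0&0&\frac{\Sigma}{\Sigma+w}&\frac{\Sigma w}{\Sigma+w}\\[4pt]A\le-\sqrt{v/w}&1&\frac{A\Sigma}{A^2\Sigma+v}&\frac{\Sigma v}{A^2\Sigma+v}\end{array}$$ Forward optimal pairs exist. A pair $(\alpha,\gamma)$ with measurable $\gamma_t$ is forward optimal if and only if there is a solution of the table with these $\alpha_t$, $t\le n$, such that almost surely $\gamma_t(r^t)=\hat x_{t|t-1}+K_t^*(r_t-c_t\hat x_{t|t-1})$ for all $t\le n$. For every solution of the table and every $t\le n$: $\alpha_t\in[0,1]$; under these $\alpha$'s, $\Sigma^*_{t|t-1}=\Sigma_{t|t-1}$, $K_t^*=K_t$ and $J_t^{d,*}=\Sigma_{t|t}$; and $J_t^{d,*}$ is the minimum of the stage cost at $t$ over $a\in[0,1]$ and measurable estimators, given $\alpha_0,\dots,\alpha_{t-1}$. Moreover $\frac1{n+1}\sum_{t=0}^nJ_t^{d,*}$ is the minimum of the average cost $\frac1{n+1}\sum_{t=0}^n\mathbf E[(x_t-\gamma_t(r^t))^2]$ over all $\alpha_0,\dots,\alpha_n\in[0,1]$ and all measurable $\gamma_0,\dots,\gamma_n$.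 -/

import Mathlib

open MeasureTheory ProbabilityTheory
open scoped NNReal ENNReal

/-- The Gauss-Markov setup over the stages `0, …, n` on a probability space `(Ω, P)`: the initial
state, the source noise `noiseN t` (`t < n`), the observation noise `noiseW t` (`t ≤ n`) and the
channel noise `noiseV t` (`t ≤ n`) are mutually independent centred Gaussian variables with positive
variances. Values at stages beyond the horizon play no role. -/
structure GaussMarkovModel {Ω : Type*} [MeasurableSpace Ω] (P : Measure Ω) (n : ℕ) where
  /-- the deterministic coefficients of the source recursion -/
  β : ℕ → ℝ
  varX0 : ℝ≥0
  varN : ℕ → ℝ≥0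
  varW : ℕ → ℝ≥0
  varV : ℕ → ℝ≥0
  varX0_pos : 0 < varX0
  varN_pos : ∀ t < n, 0 < varN t
  varW_pos : ∀ t ≤ n, 0 < varW t
  varV_pos : ∀ t ≤ n, 0 < varV t
  x0 : Ω → ℝ
  noiseN : ℕ → Ω → ℝ
  noiseW : ℕ → Ω → ℝ
  noiseV : ℕ → Ω → ℝ
  measurable_x0 : Measurable x0
  measurable_noiseN : ∀ t < n, Measurable (noiseN t)
  measurable_noiseW : ∀ t ≤ n, Measurable (noiseW t)
  measurable_noiseV : ∀ t ≤ n, Measurable (noiseV t)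
  law_x0 : HasLaw x0 (gaussianReal 0 varX0) P
  law_noiseN : ∀ t < n, HasLaw (noiseN t) (gaussianReal 0 (varN t)) P
  law_noiseW : ∀ t ≤ n, HasLaw (noiseW t) (gaussianReal 0 (varW t)) P
  law_noiseV : ∀ t ≤ n, HasLaw (noiseV t) (gaussianReal 0 (varV t)) P
  indep : iIndepFun
    (Sum.elim (fun _ : Unit => x0)
      (Sum.elim (fun t : Fin n => noiseN t)
        (Sum.elim (fun t : Fin (n + 1) => noiseW t) (fun t : Fin (n + 1) => noiseV t)))) P

/-- The linear memoryless encoder `x ↦ A t * x`. -/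
def linearEncoder (A : ℕ → ℝ) : ℕ → ℝ → ℝ := fun t x => A t * x

/-- Gain of the state in the decoder's input when the encoder is linear: `α_t A_t + 1 - α_t`. -/
def stateGain (A α : ℕ → ℝ) (t : ℕ) : ℝ := α t * A t + 1 - α t

/-- Mean squared error, with values in `[0, ∞]`. -/
noncomputable def mse {Ω : Type*} [MeasurableSpace Ω] (P : Measure Ω) (X Y : Ω → ℝ) : ℝ≥0∞ :=
  ∫⁻ ω, ENNReal.ofReal ((X ω - Y ω) ^ 2) ∂P

namespace GaussMarkovModel

variable {Ω : Type*} [MeasurableSpace Ω] {P : Measure Ω} {n : ℕ}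

/-- The source: `x_{t+1} = β_t x_t + n_t`. -/
def state (M : GaussMarkovModel P n) : ℕ → Ω → ℝ
  | 0 => M.x0
  | t + 1 => fun ω => M.β t * M.state t ω + M.noiseN t ω

/-- Output of the channel from the encoder, `y_t = m_t + v_t` with `m_t = γe_t (x_t)`. -/
def outY (M : GaussMarkovModel P n) (γe : ℕ → ℝ → ℝ) (t : ℕ) (ω : Ω) : ℝ :=
  γe t (M.state t ω) + M.noiseV t ω

/-- Direct noisy observation of the source, `z_t = x_t + w_t`. -/
def outZ (M : GaussMarkovModel P n) (t : ℕ) (ω : Ω) : ℝ :=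
  M.state t ω + M.noiseW t ω

/-- The decoder's input `r_t = α_t y_t + (1 - α_t) z_t`. -/
def received (M : GaussMarkovModel P n) (γe : ℕ → ℝ → ℝ) (α : ℕ → ℝ) (t : ℕ) (ω : Ω) : ℝ :=
  α t * M.outY γe t ω + (1 - α t) * M.outZ t ω

/-- The first `k` inputs `(r_0, …, r_{k-1})` of the decoder. -/
def history (M : GaussMarkovModel P n) (γe : ℕ → ℝ → ℝ) (α : ℕ → ℝ) (k : ℕ) (ω : Ω) :
    Fin k → ℝ :=
  fun s => M.received γe α s ω

/-- The σ-algebra generated by `(r_0, …, r_{k-1})`; it is trivial for `k = 0`. -/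
abbrev info (M : GaussMarkovModel P n) (γe : ℕ → ℝ → ℝ) (α : ℕ → ℝ) (k : ℕ) : MeasurableSpace Ω :=
  MeasurableSpace.comap (M.history γe α k) inferInstance

/-- `E[x_t | r^{t-1}]` -/
noncomputable def predMean (M : GaussMarkovModel P n) (γe : ℕ → ℝ → ℝ) (α : ℕ → ℝ) (t : ℕ) :
    Ω → ℝ :=
  P[M.state t | M.info γe α t]

/-- `E[x_t | r^t]` -/
noncomputable def filtMean (M : GaussMarkovModel P n) (γe : ℕ → ℝ → ℝ) (α : ℕ → ℝ) (t : ℕ) :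
    Ω → ℝ :=
  P[M.state t | M.info γe α (t + 1)]

/-- `E[(x_t - E[x_t | r^{t-1}])² | r^{t-1}]` -/
noncomputable def predCondVar (M : GaussMarkovModel P n) (γe : ℕ → ℝ → ℝ) (α : ℕ → ℝ) (t : ℕ) :
    Ω → ℝ :=
  P[fun ω => (M.state t ω - M.predMean γe α t ω) ^ 2 | M.info γe α t]

/-- `E[(x_t - E[x_t | r^t])² | r^t]` -/
noncomputable def filtCondVar (M : GaussMarkovModel P n) (γe : ℕ → ℝ → ℝ) (α : ℕ → ℝ) (t : ℕ) :
    Ω → ℝ :=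
  P[fun ω => (M.state t ω - M.filtMean γe α t ω) ^ 2 | M.info γe α (t + 1)]

/-- The unconditional prediction error variance. -/
noncomputable def predVar (M : GaussMarkovModel P n) (γe : ℕ → ℝ → ℝ) (α : ℕ → ℝ) (t : ℕ) : ℝ :=
  ∫ ω, (M.state t ω - M.predMean γe α t ω) ^ 2 ∂P

/-- The unconditional filtering error variance. -/
noncomputable def filtVar (M : GaussMarkovModel P n) (γe : ℕ → ℝ → ℝ) (α : ℕ → ℝ) (t : ℕ) : ℝ :=
  ∫ ω, (M.state t ω - M.filtMean γe α t ω) ^ 2 ∂P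

/-- The innovation `r_t - E[r_t | r^{t-1}]`. -/
noncomputable def innovation (M : GaussMarkovModel P n) (γe : ℕ → ℝ → ℝ) (α : ℕ → ℝ) (t : ℕ) :
    Ω → ℝ :=
  fun ω => M.received γe α t ω - (P[M.received γe α t | M.info γe α t]) ω

/-- The Kalman gain for the linear encoder:
prediction variance times state gain, divided by the variance of the innovation. -/
noncomputable def kalmanGain (M : GaussMarkovModel P n) (A α : ℕ → ℝ) (t : ℕ) : ℝ :=
  M.predVar (linearEncoder A) α t * stateGain A α t
    / variance (M.innovation (linearEncoder A) α t) P

/-- The decoder's cost at stage `t` for combining parameters `α` and estimator `g` of `x_t`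
from `r^t`. -/
noncomputable def stageCost (M : GaussMarkovModel P n) (γe : ℕ → ℝ → ℝ) (α : ℕ → ℝ) (t : ℕ)
    (g : (Fin (t + 1) → ℝ) → ℝ) : ℝ≥0∞ :=
  mse P (M.state t) (fun ω => g (M.history γe α (t + 1) ω))

/-- `(α, γ)` is admissible for the decoder: `α_t ∈ [0, 1]` and `γ_t` is measurable. -/
def Admissible (n : ℕ) (α : ℕ → ℝ) (γ : (t : ℕ) → (Fin (t + 1) → ℝ) → ℝ) : Prop :=
  ∀ t ≤ n, α t ∈ Set.Icc (0 : ℝ) 1 ∧ Measurable (γ t)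

/-- Stage-wise (myopic) optimality, forward in time: at every stage `t`, with the combining
parameters of the earlier stages kept, `(α_t, γ_t)` minimises the cost of stage `t` over all
`a ∈ [0, 1]` and all measurable estimators `g` of `x_t` from `r^t`. -/
def IsForwardOptimal (M : GaussMarkovModel P n) (γe : ℕ → ℝ → ℝ) (α : ℕ → ℝ)
    (γ : (t : ℕ) → (Fin (t + 1) → ℝ) → ℝ) : Prop :=
  Admissible n α γ ∧
    ∀ t ≤ n, ∀ a ∈ Set.Icc (0 : ℝ) 1, ∀ g : (Fin (t + 1) → ℝ) → ℝ, Measurable g →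
      M.stageCost γe α t (γ t) ≤ M.stageCost γe (Function.update α t a) t g

/-- The decoder's average total cost over the stages `0, …, n`. -/
noncomputable def averageCost (M : GaussMarkovModel P n) (γe : ℕ → ℝ → ℝ) (α : ℕ → ℝ)
    (γ : (t : ℕ) → (Fin (t + 1) → ℝ) → ℝ) : ℝ≥0∞ :=
  (∑ t ∈ Finset.range (n + 1), M.stageCost γe α t (γ t)) / ((n : ℝ≥0∞) + 1)

/-- The three-case table for one stage, with encoder gain `A`, prediction variance `S` and noise
variances `w`, `v`: combining parameter `a`, gain `K` and cost `J`. The cases overlap at `A = 0`,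
where they agree, and at `A = -√(v / w)`, where both parameters `0` and `1` are allowed. -/
def TableRow (A S w v a K J : ℝ) : Prop :=
  (0 ≤ A ∧
    a = A * w / (A * w + v) ∧
    K = (A * S * w + S * v) / (A ^ 2 * S * w + S * v + w * v) ∧
    J = S * w * v / ((A ^ 2 * w + v) * S + w * v)) ∨
  (-√(v / w) ≤ A ∧ A ≤ 0 ∧
    a = 0 ∧
    K = S / (S + w) ∧
    J = S * w / (S + w)) ∨
  (A ≤ -√(v / w) ∧
    a = 1 ∧
    K = A * S / (A ^ 2 * S + v) ∧
    J = S * v / (A ^ 2 * S + v))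

/-- `(α, K, J)` with prediction variances `S` is computed forward in time from the table:
`S_0 = σ²_{x_0}`, `S_{t+1} = β_t² J_t + σ²_{n_t}`, and stage `t` is the row of the table for `S_t`. -/
def SolvesTable (M : GaussMarkovModel P n) (A α K J S : ℕ → ℝ) : Prop :=
  S 0 = M.varX0 ∧
  (∀ t < n, S (t + 1) = M.β t ^ 2 * J t + M.varN t) ∧
  ∀ t ≤ n, TableRow (A t) (S t) (M.varW t) (M.varV t) (α t) (K t) (J t)

end GaussMarkovModel

/-! The probabilistic half rests on one invariant, `IsGaussianPredictor`: the error `X - φ(H)` is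
centred Gaussian and independent of the observation `H`. Independence gives at once that `φ(H)` is
the conditional mean, that the conditional error variance is constant, and, by Pythagoras, that
`φ(H)` is the a.s. unique estimator of least mean squared error. A linear encoder turns each input
of the decoder into a scalar observation `c x + noise`, so the invariant propagates in time:
`update` absorbs an observation, because the new error is uncorrelated with the innovation and
hence, by joint Gaussianity, independent of it; `affine` advances the source.

What remains is scalar. The least stage cost is `posteriorVar`, that is `S q / (c² S + q)` with `c =
a A + 1 - a` and `q` the combined noise variance. For `S > 0` it decreases in the signal-to-noise
ratio `c² / q`, so the best `a` does not depend on `S`. For `A ≥ 0` the optimum is the equality case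
of Cauchy–Schwarz; for `A < 0` that point leaves `[0, 1]` and an endpoint wins, which one depending
on the sign of `A² w - v`. `exists_tableRow_of_forall_le` shows that there are no other minimisers.
Finally `posteriorVar` is monotone in `S` (`posteriorVar_mono`), so greedy choices minimise all
stage costs simultaneously (`SolvesTable.riccati_le`), and therefore their average. -/

/-- `φ ∘ H` predicts `X` from the observation `H` with an error that is independent of `H`, centred
Gaussian, and of variance `S`. -/
structure IsGaussianPredictor {Ω E : Type*} [MeasurableSpace Ω] [MeasurableSpace E]
    (P : Measure Ω) (X : Ω → ℝ) (H : Ω → E) (φ : E → ℝ) (S : ℝ) : Prop where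
  measurable_target : Measurable X
  measurable_obs : Measurable H
  measurable_map : Measurable φ
  hasGaussianLaw : HasGaussianLaw (fun ω => X ω - φ (H ω)) P
  integral_eq_zero : ∫ ω, (X ω - φ (H ω)) ∂P = 0
  variance_eq : variance (fun ω => X ω - φ (H ω)) P = S
  indep : IndepFun H (fun ω => X ω - φ (H ω)) P

theorem ProbabilityTheory.HasLaw.integral_gaussianReal_zero {Ω : Type*} [MeasurableSpace Ω]
    {P : Measure Ω} {X : Ω → ℝ} {v : ℝ≥0} (h : HasLaw X (gaussianReal 0 v) P) :
    ∫ ω, X ω ∂P = 0 := by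
  rw [h.integral_eq, integral_id_gaussianReal]

theorem ProbabilityTheory.HasLaw.variance_gaussianReal {Ω : Type*} [MeasurableSpace Ω]
    {P : Measure Ω} {X : Ω → ℝ} {m : ℝ} {v : ℝ≥0} (h : HasLaw X (gaussianReal m v) P) :
    variance X P = v := by
  rw [h.variance_eq, variance_id_gaussianReal]

/-- If `X ⟂ Y` and `(X, Y) ⟂ Z`, then `X ⟂ (Y, Z)`. -/
theorem indepFun_prodMk_right_of_prodMk_left {Ω α β γ : Type*} [MeasurableSpace Ω]
    [MeasurableSpace α] [MeasurableSpace β] [MeasurableSpace γ] {P : Measure Ω}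
    [IsProbabilityMeasure P] {X : Ω → α} {Y : Ω → β} {Z : Ω → γ}
    (hX : Measurable X) (hY : Measurable Y) (hZ : Measurable Z)
    (hXY : IndepFun X Y P) (hXYZ : IndepFun (fun ω => (X ω, Y ω)) Z P) :
    IndepFun X (fun ω => (Y ω, Z ω)) P := by
  have := Measure.isProbabilityMeasure_map (μ := P) hX.aemeasurable
  have := Measure.isProbabilityMeasure_map (μ := P) hY.aemeasurable
  have := Measure.isProbabilityMeasure_map (μ := P) hZ.aemeasurable
  have hYZ : IndepFun Y Z P := hXYZ.comp measurable_snd measurable_id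
  rw [indepFun_iff_map_prod_eq_prod_map_map (by fun_prop) (by fun_prop)] at *
  rw [hYZ, ← Measure.prodAssoc_prod, ← hXY, ← hXYZ,
    Measure.map_map (by fun_prop) (by fun_prop)]
  rfl

/-- Orthogonal decomposition of the mean squared error, also when the error is infinite. -/
theorem lintegral_add_sq_of_indepFun {Ω : Type*} [MeasurableSpace Ω] {P : Measure Ω}
    [IsProbabilityMeasure P] {e d : Ω → ℝ} (he : Measurable e) (hd : Measurable d)
    (h2 : MemLp e 2 P) (h0 : ∫ ω, e ω ∂P = 0) (hed : IndepFun d e P) :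
    ∫⁻ ω, ENNReal.ofReal ((e ω + d ω) ^ 2) ∂P
      = ENNReal.ofReal (variance e P) + ∫⁻ ω, ENNReal.ofReal (d ω ^ 2) ∂P := by
  have := Measure.isProbabilityMeasure_map (μ := P) he.aemeasurable
  have := Measure.isProbabilityMeasure_map (μ := P) hd.aemeasurable
  have hi : Integrable e P := h2.integrable (by norm_num)
  -- The value `y` of `d` is frozen and `e` is integrated first. Only `e` has to be square
  -- integrable; `d` enters through Tonelli and may have infinite second moment.
  have hpt (y : ℝ) : ∫⁻ ω, ENNReal.ofReal ((e ω + y) ^ 2) ∂P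
      = ENNReal.ofReal (variance e P) + ENNReal.ofReal (y ^ 2) := by
    have hint : Integrable (fun ω => e ω ^ 2 + (2 * y * e ω + y ^ 2)) P :=
      h2.integrable_sq.add ((hi.const_mul _).add (integrable_const _))
    rw [← ENNReal.ofReal_add (variance_nonneg _ _) (sq_nonneg y),
      variance_of_integral_eq_zero he.aemeasurable h0]
    simp_rw [show ∀ ω, (e ω + y) ^ 2 = e ω ^ 2 + (2 * y * e ω + y ^ 2) from fun ω => by ring]
    rw [← ofReal_integral_eq_lintegral_ofReal hint
      (.of_forall fun ω => by dsimp only [Pi.zero_apply]; nlinarith [sq_nonneg (e ω + y)])]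
    have h1 : ∫ ω, (e ω ^ 2 + (2 * y * e ω + y ^ 2)) ∂P
        = ∫ ω, e ω ^ 2 ∂P + ∫ ω, (2 * y * e ω + y ^ 2) ∂P :=
      integral_add h2.integrable_sq ((hi.const_mul _).add (integrable_const _))
    rw [h1, integral_add (hi.const_mul _) (integrable_const _), integral_const_mul, h0]
    simp
  have hmap := hed.map_prod_eq_prod_map_map hd.aemeasurable he.aemeasurable
  calc ∫⁻ ω, ENNReal.ofReal ((e ω + d ω) ^ 2) ∂P
      = ∫⁻ z, ENNReal.ofReal ((z.2 + z.1) ^ 2) ∂(P.map fun ω => (d ω, e ω)) := by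
        rw [lintegral_map (by fun_prop) (by fun_prop)]
    _ = ∫⁻ y, ∫⁻ x, ENNReal.ofReal ((x + y) ^ 2) ∂(P.map e) ∂(P.map d) := by
        rw [hmap, lintegral_prod _ (by fun_prop)]
    _ = ∫⁻ y, (ENNReal.ofReal (variance e P) + ENNReal.ofReal (y ^ 2)) ∂(P.map d) := by
        congr 1 with y
        rw [lintegral_map (by fun_prop) he, hpt]
    _ = _ := by
        rw [lintegral_add_left (by fun_prop), lintegral_map (f := fun y => ENNReal.ofReal (y ^ 2))
          (by fun_prop) hd]
        simp

/-! ### Predictors with independent Gaussian error: conditional moments, optimality, propagation. -/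

namespace IsGaussianPredictor

variable {Ω E : Type*} [MeasurableSpace Ω] [MeasurableSpace E] {P : Measure Ω}
  [IsProbabilityMeasure P] {X : Ω → ℝ} {H : Ω → E} {φ : E → ℝ} {S : ℝ}

omit [IsProbabilityMeasure P] in
theorem measurable_error (h : IsGaussianPredictor P X H φ S) :
    Measurable fun ω => X ω - φ (H ω) :=
  h.measurable_target.sub (h.measurable_map.comp h.measurable_obs)

omit [IsProbabilityMeasure P] in
theorem integral_sq (h : IsGaussianPredictor P X H φ S) :
    ∫ ω, (X ω - φ (H ω)) ^ 2 ∂P = S := by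
  rw [← h.variance_eq, variance_of_integral_eq_zero h.measurable_error.aemeasurable
    h.integral_eq_zero]

/-- The error is independent of the conditioning σ-algebra. `f = id` serves the conditional mean, `f
= (· ^ 2)` the conditional variance. -/
theorem condExp_error_comp (h : IsGaussianPredictor P X H φ S) {f : ℝ → ℝ} (hf : Measurable f) :
    P[fun ω => f (X ω - φ (H ω)) | MeasurableSpace.comap H inferInstance]
      =ᵐ[P] fun _ => ∫ ω, f (X ω - φ (H ω)) ∂P := by
  refine condExp_indep_eq (m₁ := MeasurableSpace.comap (fun ω => X ω - φ (H ω)) inferInstance)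
    h.measurable_error.comap_le h.measurable_obs.comap_le ?_ ?_
  · exact (hf.comp (comap_measurable _)).stronglyMeasurable
  · exact ((IndepFun_iff_Indep _ _ _).1 h.indep).symm

theorem condExp_eq (h : IsGaussianPredictor P X H φ S) (hX : Integrable X P) :
    P[X | MeasurableSpace.comap H inferInstance] =ᵐ[P] fun ω => φ (H ω) := by
  have hφ : Integrable (fun ω => φ (H ω)) P := by
    refine (hX.sub h.hasGaussianLaw.integrable).congr (.of_forall fun ω => ?_)
    simp
  have h1 := condExp_sub hX hφ (MeasurableSpace.comap H inferInstance)
  have h2 := h.condExp_error_comp measurable_id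
  have h3 : P[fun ω => φ (H ω) | MeasurableSpace.comap H inferInstance] = fun ω => φ (H ω) :=
    condExp_of_stronglyMeasurable h.measurable_obs.comap_le
      (h.measurable_map.comp (comap_measurable H)).stronglyMeasurable hφ
  have h4 : (fun ω => id (X ω - φ (H ω))) = X - fun ω => φ (H ω) := rfl
  simp only [id_eq, h.integral_eq_zero] at h2
  rw [h3] at h1
  filter_upwards [h1, h2] with ω a b
  have : (P[X - fun ω => φ (H ω) | MeasurableSpace.comap H inferInstance]) ω = 0 := b
  rw [this, Pi.sub_apply] at a
  linarith

theorem integral_sq_sub_condExp (h : IsGaussianPredictor P X H φ S) (hX : Integrable X P) :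
    ∫ ω, (X ω - (P[X | MeasurableSpace.comap H inferInstance]) ω) ^ 2 ∂P = S := by
  rw [← h.integral_sq]
  refine integral_congr_ae ?_
  filter_upwards [h.condExp_eq hX] with ω a
  rw [a]

theorem condExp_sq_sub_condExp (h : IsGaussianPredictor P X H φ S) (hX : Integrable X P) :
    P[fun ω => (X ω - (P[X | MeasurableSpace.comap H inferInstance]) ω) ^ 2
      | MeasurableSpace.comap H inferInstance] =ᵐ[P] fun _ => S := by
  rw [← h.integral_sq]
  refine (condExp_congr_ae ?_).trans (h.condExp_error_comp (f := fun x => x ^ 2) (by fun_prop))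
  filter_upwards [h.condExp_eq hX] with ω a
  rw [a]

/-- Pythagoras for `X - g(H) = (X - φ(H)) + (φ - g)(H)`. Working in `[0, ∞]` admits estimators `g`
without any integrability. -/
theorem mse_eq (h : IsGaussianPredictor P X H φ S) {g : E → ℝ} (hg : Measurable g) :
    mse P X (fun ω => g (H ω))
      = ENNReal.ofReal S + ∫⁻ ω, ENNReal.ofReal ((φ (H ω) - g (H ω)) ^ 2) ∂P := by
  have hφ := h.measurable_map
  have hH := h.measurable_obs
  rw [← h.variance_eq, ← lintegral_add_sq_of_indepFun (d := fun ω => φ (H ω) - g (H ω))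
    h.measurable_error (by fun_prop) h.hasGaussianLaw.memLp_two h.integral_eq_zero
    (h.indep.comp (hφ.sub hg) measurable_id)]
  unfold mse
  congr 1 with ω
  simp

theorem mse_condExp (h : IsGaussianPredictor P X H φ S) (hX : Integrable X P) :
    mse P X (P[X | MeasurableSpace.comap H inferInstance]) = ENNReal.ofReal S := by
  have h1 : mse P X (P[X | MeasurableSpace.comap H inferInstance])
      = mse P X (fun ω => φ (H ω)) := by
    refine lintegral_congr_ae ?_
    filter_upwards [h.condExp_eq hX] with ω a
    rw [a]
  rw [h1, h.mse_eq h.measurable_map]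
  simp

theorem le_mse (h : IsGaussianPredictor P X H φ S) {g : E → ℝ} (hg : Measurable g) :
    ENNReal.ofReal S ≤ mse P X (fun ω => g (H ω)) := by
  rw [h.mse_eq hg]
  exact le_self_add

theorem mse_eq_iff (h : IsGaussianPredictor P X H φ S) {g : E → ℝ} (hg : Measurable g) :
    mse P X (fun ω => g (H ω)) = ENNReal.ofReal S
      ↔ (fun ω => g (H ω)) =ᵐ[P] fun ω => φ (H ω) := by
  have hφ := h.measurable_map
  have hH := h.measurable_obs
  have hadd (a : ℝ≥0∞) : ENNReal.ofReal S + a = ENNReal.ofReal S ↔ a = 0 := by simp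
  rw [h.mse_eq hg, hadd, lintegral_eq_zero_iff (by fun_prop)]
  refine ⟨fun a => ?_, fun a => ?_⟩
  · filter_upwards [a] with ω b
    have : (φ (H ω) - g (H ω)) ^ 2 ≤ 0 := by simpa using b
    nlinarith [sq_eq_zero_iff.1 (le_antisymm this (sq_nonneg _))]
  · filter_upwards [a] with ω b
    simp [b]

/-- Prediction of `b X + N` when the noise `N` is independent of the error and the observation. -/
theorem affine (h : IsGaussianPredictor P X H φ S) {N : Ω → ℝ} (hN : Measurable N)
    (hgN : HasGaussianLaw N P) (hN0 : ∫ ω, N ω ∂P = 0)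
    (hind : IndepFun (fun ω => (H ω, X ω - φ (H ω))) N P) (b : ℝ) :
    IsGaussianPredictor P (fun ω => b * X ω + N ω) H (fun y => b * φ y)
      (b ^ 2 * S + variance N P) := by
  have hm := h.measurable_error
  have hX := h.measurable_target
  have hφ := h.measurable_map
  have hH := h.measurable_obs
  have heq : (fun ω => b * X ω + N ω - b * φ (H ω)) = fun ω => b * (X ω - φ (H ω)) + N ω := by
    ext ω; ring
  have heN : IndepFun (fun ω => b * (X ω - φ (H ω))) N P :=
    hind.comp (φ := fun z : E × ℝ => b * z.2) (by fun_prop) measurable_id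
  have hg : HasGaussianLaw (fun ω => b * (X ω - φ (H ω))) P := h.hasGaussianLaw.fun_smul b
  -- Independence of `H` from the pair (old error, noise) is what passes to their linear
  -- combination, the new error.
  have hHeN := indepFun_prodMk_right_of_prodMk_left hH hm hN h.indep hind
  refine ⟨by fun_prop, hH, by fun_prop, ?_, ?_, ?_, ?_⟩
  · rw [heq]
    exact (heN.hasGaussianLaw hg hgN).fun_add
  · rw [heq, integral_add hg.integrable hgN.integrable, integral_const_mul, h.integral_eq_zero, hN0]
    simp
  · rw [heq, heN.variance_fun_add hg.memLp_two hgN.memLp_two, variance_const_mul, h.variance_eq]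
  · rw [heq]
    exact hHeN.comp (ψ := fun z : ℝ × ℝ => b * z.1 + z.2) measurable_id (by fun_prop)

/-- Bayesian update: the Kalman filter step for the additional observation `c X + N`. -/
theorem update (h : IsGaussianPredictor P X H φ S) {N : Ω → ℝ} (hN : Measurable N)
    (hgN : HasGaussianLaw N P) (hN0 : ∫ ω, N ω ∂P = 0)
    (hind : IndepFun (fun ω => (H ω, X ω - φ (H ω))) N P) (c : ℝ)
    (hV : c ^ 2 * S + variance N P ≠ 0)
    {E' : Type*} [MeasurableSpace E'] {ρ : E' → E} {r : E' → ℝ} {ψ : E × ℝ → E'}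
    (hρ : Measurable ρ) (hr : Measurable r) (hψ : Measurable ψ) {H' : Ω → E'}
    (hH' : ∀ ω, H' ω = ψ (H ω, c * X ω + N ω))
    (hHρ : ∀ ω, ρ (H' ω) = H ω) (hHr : ∀ ω, r (H' ω) = c * X ω + N ω) :
    IsGaussianPredictor P X H'
      (fun y => φ (ρ y) + S * c / (c ^ 2 * S + variance N P) * (r y - c * φ (ρ y)))
      ((1 - S * c / (c ^ 2 * S + variance N P) * c) * S) := by
  have hm := h.measurable_error
  have hX := h.measurable_target
  have hφ := h.measurable_map
  have hH := h.measurable_obs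
  set q := variance N P with hq
  set K := S * c / (c ^ 2 * S + q) with hK
  -- The normal equation defining the gain; it is the only property of `K` used in the covariance
  -- and variance computations below.
  have hKV : K * (c ^ 2 * S + q) = S * c := div_mul_cancel₀ _ hV
  set e : Ω → ℝ := fun ω => X ω - φ (H ω) with he
  have heN : IndepFun e N P := hind.comp measurable_snd measurable_id
  have heg : HasGaussianLaw e P := h.hasGaussianLaw
  have heqN : HasGaussianLaw (fun ω => (e ω, N ω)) P := heN.hasGaussianLaw heg hgN
  have hHeN := indepFun_prodMk_right_of_prodMk_left hH hm hN h.indep hind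
  have heq : (fun ω => X ω - (φ (ρ (H' ω)) + K * (r (H' ω) - c * φ (ρ (H' ω)))))
      = fun ω => (1 - K * c) * e ω + (-K) * N ω := by
    ext ω; rw [hHρ, hHr]; simp only [he]; ring
  have hfI : HasGaussianLaw (fun ω => ((1 - K * c) * e ω + (-K) * N ω, c * e ω + 1 * N ω)) P :=
    heqN.map_fun
      (((1 - K * c) • ContinuousLinearMap.fst ℝ ℝ ℝ + (-K) • ContinuousLinearMap.snd ℝ ℝ ℝ).prod
        (c • ContinuousLinearMap.fst ℝ ℝ ℝ + (1 : ℝ) • ContinuousLinearMap.snd ℝ ℝ ℝ))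
  have hcov0 : covariance e N P = 0 := heN.covariance_eq_zero heg.memLp_two hgN.memLp_two
  have hL (a : ℝ) : MemLp (fun ω => a * e ω) 2 P := heg.memLp_two.const_mul a
  have hL' (a : ℝ) : MemLp (fun ω => a * N ω) 2 P := hgN.memLp_two.const_mul a
  -- The new error against the innovation `c e + N`: the covariance is `c S - K (c² S + q)`, which
  -- the choice of `K` annihilates.
  have hcov : covariance (fun ω => (1 - K * c) * e ω + (-K) * N ω)
      (fun ω => c * e ω + 1 * N ω) P = 0 := by
    rw [show (fun ω => (1 - K * c) * e ω + (-K) * N ω)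
        = (fun ω => (1 - K * c) * e ω) + fun ω => (-K) * N ω from rfl,
      show (fun ω => c * e ω + 1 * N ω) = (fun ω => c * e ω) + fun ω => 1 * N ω from rfl,
      covariance_add_left (hL _) (hL' _) ((hL _).add (hL' _)),
      covariance_add_right (hL _) (hL _) (hL' _),
      covariance_add_right (hL' _) (hL _) (hL' _)]
    simp only [covariance_const_mul_left, covariance_const_mul_right, covariance_comm N e, hcov0]
    rw [covariance_self hm.aemeasurable, covariance_self hN.aemeasurable, h.variance_eq, ← hq]
    linear_combination -hKV
  have hfIind := hfI.indepFun_of_covariance_eq_zero hcov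
  have hHfI : IndepFun H
      (fun ω => (c * e ω + 1 * N ω, (1 - K * c) * e ω + (-K) * N ω)) P :=
    hHeN.comp (ψ := fun z : ℝ × ℝ => (c * z.1 + 1 * z.2, (1 - K * c) * z.1 + (-K) * z.2))
      measurable_id (by fun_prop)
  -- The new error is independent of the innovation, and the pair of both is independent of `H`; so
  -- the new error is independent of `H` and the innovation jointly.
  have hHI_f : IndepFun (fun ω => (H ω, c * e ω + 1 * N ω))
      (fun ω => (1 - K * c) * e ω + (-K) * N ω) P := by
    have hHI : IndepFun H (fun ω => c * e ω + 1 * N ω) P :=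
      hHfI.comp measurable_id measurable_fst
    have h1 : IndepFun (fun ω => ((1 - K * c) * e ω + (-K) * N ω, c * e ω + 1 * N ω)) H P :=
      (hHfI.comp measurable_id measurable_swap).symm
    have h2 := indepFun_prodMk_right_of_prodMk_left (by fun_prop) (by fun_prop) hH hfIind h1
    exact (h2.comp measurable_id measurable_swap).symm
  -- The new observation is a function of `H` and the innovation, so it inherits their independence
  -- from the new error.
  have hH'' : H' = fun ω => ψ (H ω, c * φ (H ω) + (c * e ω + 1 * N ω)) := by
    ext ω
    rw [hH' ω]
    congr 2
    simp only [he]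
    ring
  have hH'm : Measurable H' := by
    rw [hH'']
    fun_prop
  refine ⟨hX, hH'm, by fun_prop, ?_, ?_, ?_, ?_⟩
  · rw [heq]; exact hfI.fst
  · rw [heq, integral_add ((hL _).integrable (by norm_num)) ((hL' _).integrable (by norm_num)),
      integral_const_mul, integral_const_mul, h.integral_eq_zero, hN0]
    simp
  · rw [heq]
    have : IndepFun (fun ω => (1 - K * c) * e ω) (fun ω => (-K) * N ω) P :=
      heN.comp (φ := fun z => (1 - K * c) * z) (ψ := fun z => (-K) * z) (by fun_prop) (by fun_prop)
    rw [this.variance_fun_add (hL _) (hL' _), variance_const_mul, variance_const_mul,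
      h.variance_eq, ← hq]
    linear_combination K * hKV
  · rw [heq, hH'']
    exact hHI_f.comp (φ := fun z : E × ℝ => ψ (z.1, c * φ z.1 + z.2)) (by fun_prop) measurable_id

end IsGaussianPredictor

/-! ### The scalar one-stage problem: posterior variance as a function of the combining parameter.
-/

/-- Variance of the noise in `a (A x + v) + (1 - a) (x + w)`. -/
def combinedNoiseVar (w v a : ℝ) : ℝ := (1 - a) ^ 2 * w + a ^ 2 * v

/-- Variance of the innovation for prediction variance `S` and combining parameter `a`. -/
def innovationVar (A w v S a : ℝ) : ℝ := (a * A + 1 - a) ^ 2 * S + combinedNoiseVar w v a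

/-- Error variance of the Kalman filter for prediction variance `S` and combining parameter `a`. -/
noncomputable def posteriorVar (A w v S a : ℝ) : ℝ :=
  (1 - S * (a * A + 1 - a) / innovationVar A w v S a * (a * A + 1 - a)) * S

section Scalar

variable {A w v S : ℝ}

theorem combinedNoiseVar_pos (hw : 0 < w) (hv : 0 < v) (a : ℝ) : 0 < combinedNoiseVar w v a := by
  unfold combinedNoiseVar
  rcases eq_or_ne a 0 with rfl | ha
  · simpa using hw
  · positivity

theorem innovationVar_pos (hw : 0 < w) (hv : 0 < v) (hS : 0 ≤ S) (A a : ℝ) :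
    0 < innovationVar A w v S a := by
  have := combinedNoiseVar_pos hw hv a
  unfold innovationVar
  positivity

theorem posteriorVar_eq_div (hw : 0 < w) (hv : 0 < v) (hS : 0 ≤ S) (A a : ℝ) :
    posteriorVar A w v S a = S * combinedNoiseVar w v a / innovationVar A w v S a := by
  have h := (innovationVar_pos hw hv hS A a).ne'
  rw [posteriorVar, eq_div_iff h, div_mul_eq_mul_div, sub_mul, sub_mul, div_mul_eq_mul_div,
    div_mul_cancel₀ _ h]
  unfold innovationVar
  ring

theorem posteriorVar_pos (hw : 0 < w) (hv : 0 < v) (hS : 0 < S) (A a : ℝ) :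
    0 < posteriorVar A w v S a := by
  rw [posteriorVar_eq_div hw hv hS.le]
  exact div_pos (mul_pos hS (combinedNoiseVar_pos hw hv a)) (innovationVar_pos hw hv hS.le A a)

/-- After cross-multiplication the terms with `S S'` cancel and `S q² ≤ S' q²` remains. This is why
lowering an early cost never hurts a later one. -/
theorem posteriorVar_mono {S' : ℝ} (hw : 0 < w) (hv : 0 < v) (hS : 0 ≤ S) (hSS' : S ≤ S')
    (A a : ℝ) : posteriorVar A w v S a ≤ posteriorVar A w v S' a := by
  have hS' := hS.trans hSS'
  rw [posteriorVar_eq_div hw hv hS, posteriorVar_eq_div hw hv hS',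
    div_le_div_iff₀ (innovationVar_pos hw hv hS A a) (innovationVar_pos hw hv hS' A a)]
  have := mul_le_mul_of_nonneg_right hSS' (sq_nonneg (combinedNoiseVar w v a))
  unfold innovationVar
  linarith

/-- Smaller posterior variance means larger signal-to-noise ratio. -/
theorem posteriorVar_le_iff (hw : 0 < w) (hv : 0 < v) (hS : 0 < S) (A a b : ℝ) :
    posteriorVar A w v S a ≤ posteriorVar A w v S b ↔
      (b * A + 1 - b) ^ 2 * combinedNoiseVar w v a
        ≤ (a * A + 1 - a) ^ 2 * combinedNoiseVar w v b := by
  rw [posteriorVar_eq_div hw hv hS.le, posteriorVar_eq_div hw hv hS.le,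
    div_le_div_iff₀ (innovationVar_pos hw hv hS.le A a) (innovationVar_pos hw hv hS.le A b),
    ← sub_nonneg, ← sub_nonneg (b := (b * A + 1 - b) ^ 2 * combinedNoiseVar w v a)]
  -- The difference of the two cross products is `S²` times the difference of the signal-to-noise
  -- comparison.
  have h2 : 0 < S * S := by positivity
  rw [← mul_nonneg_iff_of_pos_left h2 (b := (a * A + 1 - a) ^ 2 * combinedNoiseVar w v b - _)]
  unfold innovationVar
  ring_nf

theorem neg_sqrt_div_le_iff (hw : 0 < w) (hv : 0 < v) (hA : A ≤ 0) :
    -√(v / w) ≤ A ↔ A ^ 2 * w ≤ v := by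
  rw [neg_le, Real.le_sqrt (by linarith), neg_sq, le_div_iff₀ hw]
  positivity

theorem le_neg_sqrt_div_iff (hw : 0 < w) : A ≤ -√(v / w) ↔ A ≤ 0 ∧ v ≤ A ^ 2 * w := by
  rw [le_neg]
  by_cases hA : A ≤ 0
  · rw [Real.sqrt_le_left (by linarith), neg_sq, div_le_iff₀ hw]
    simp [hA]
  · have := Real.sqrt_nonneg (v / w)
    simp only [hA, false_and, iff_false]
    linarith

/-- The Lagrange identity behind Cauchy–Schwarz for `((1 - a)√w, a√v)` and `(1/√w, A/√v)`,
multiplied by `w v`. It bounds the signal-to-noise ratio by `(A² w + v) / (w v)`, and the square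
vanishes exactly when `a (A w + v) = A w`. -/
theorem combinedNoiseVar_mul_sub_sq (A w v a : ℝ) :
    combinedNoiseVar w v a * (A ^ 2 * w + v) - (a * A + 1 - a) ^ 2 * (w * v)
      = ((1 - a) * (A * w) - a * v) ^ 2 := by
  unfold combinedNoiseVar; ring

theorem stateGain_optimal {a : ℝ} (hD : A * w + v ≠ 0) (ha : a = A * w / (A * w + v)) :
    a * A + 1 - a = (A ^ 2 * w + v) / (A * w + v) := by
  subst ha; field_simp; ring

theorem combinedNoiseVar_optimal {a : ℝ} (hD : A * w + v ≠ 0) (ha : a = A * w / (A * w + v)) :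
    combinedNoiseVar w v a = w * v * (A ^ 2 * w + v) / (A * w + v) ^ 2 := by
  subst ha; unfold combinedNoiseVar; field_simp; ring

end Scalar

/-! ### The rows of the table are exactly the minimisers of the posterior variance. -/

namespace GaussMarkovModel

variable {A w v S : ℝ}

theorem TableRow.mem_Icc {a K J : ℝ} (hw : 0 < w) (hv : 0 < v) (h : TableRow A S w v a K J) :
    a ∈ Set.Icc (0 : ℝ) 1 := by
  rcases h with ⟨hA, rfl, -, -⟩ | ⟨-, -, rfl, -, -⟩ | ⟨-, rfl, -, -⟩
  · have : 0 ≤ A * w := by positivity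
    exact ⟨by positivity, (div_le_one (by linarith)).2 (by linarith)⟩
  · simp
  · simp

theorem TableRow.gain_eq {a K J : ℝ} (hw : 0 < w) (hv : 0 < v) (hS : 0 < S)
    (h : TableRow A S w v a K J) :
    K = S * (a * A + 1 - a) / innovationVar A w v S a := by
  rcases h with ⟨hA, ha, rfl, -⟩ | ⟨-, -, rfl, rfl, -⟩ | ⟨-, rfl, rfl, -⟩
  · have hD : 0 < A * w + v := by positivity
    have hE : 0 < A ^ 2 * w + v := by positivity
    have hF : 0 < (A ^ 2 * w + v) * S + w * v := by positivity
    rw [innovationVar, stateGain_optimal hD.ne' ha, combinedNoiseVar_optimal hD.ne' ha]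
    have h1 : ((A ^ 2 * w + v) / (A * w + v)) ^ 2 * S
        + w * v * (A ^ 2 * w + v) / (A * w + v) ^ 2
        = (A ^ 2 * w + v) * ((A ^ 2 * w + v) * S + w * v) / (A * w + v) ^ 2 := by
      field_simp
    have h2 : A ^ 2 * S * w + S * v + w * v = (A ^ 2 * w + v) * S + w * v := by ring
    rw [h1, h2]
    field_simp
  · simp [innovationVar, combinedNoiseVar]
  · simp [innovationVar, combinedNoiseVar, mul_comm]

theorem TableRow.cost_eq {a K J : ℝ} (hw : 0 < w) (hv : 0 < v) (hS : 0 < S)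
    (h : TableRow A S w v a K J) : J = posteriorVar A w v S a := by
  rw [posteriorVar_eq_div hw hv hS.le]
  rcases h with ⟨hA, ha, -, rfl⟩ | ⟨-, -, rfl, -, rfl⟩ | ⟨-, rfl, -, rfl⟩
  · have hD : 0 < A * w + v := by positivity
    have hE : 0 < A ^ 2 * w + v := by positivity
    have hF : 0 < (A ^ 2 * w + v) * S + w * v := by positivity
    rw [innovationVar, stateGain_optimal hD.ne' ha, combinedNoiseVar_optimal hD.ne' ha]
    have h1 : ((A ^ 2 * w + v) / (A * w + v)) ^ 2 * S
        + w * v * (A ^ 2 * w + v) / (A * w + v) ^ 2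
        = (A ^ 2 * w + v) * ((A ^ 2 * w + v) * S + w * v) / (A * w + v) ^ 2 := by
      field_simp
    rw [h1]
    field_simp
  · simp [innovationVar, combinedNoiseVar]
  · simp [innovationVar, combinedNoiseVar]

/-- For `A ≥ 0` this is the Cauchy–Schwarz bound. Against the endpoint `0` the claim becomes `b² (v
- A² w) + 2 b (1 - b) (-A) w ≥ 0`, and against the endpoint `1` it becomes `(1 - b)² (A² w - v) + 2
b (1 - b) (-A) v ≥ 0`; both terms are nonnegative in the respective case. -/
theorem TableRow.posteriorVar_le {a K J : ℝ} (hw : 0 < w) (hv : 0 < v) (hS : 0 < S)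
    (h : TableRow A S w v a K J) {b : ℝ} (hb : b ∈ Set.Icc (0 : ℝ) 1) :
    posteriorVar A w v S a ≤ posteriorVar A w v S b := by
  rw [posteriorVar_le_iff hw hv hS]
  have hb1 : 0 ≤ 1 - b := sub_nonneg.2 hb.2
  have hb0 := hb.1
  rcases h with ⟨hA, ha, -, -⟩ | ⟨h1, hA, rfl, -, -⟩ | ⟨h1, rfl, -, -⟩
  · have hD : 0 < A * w + v := by positivity
    have hE : 0 < A ^ 2 * w + v := by positivity
    rw [stateGain_optimal hD.ne' ha, combinedNoiseVar_optimal hD.ne' ha, div_pow,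
      div_mul_eq_mul_div, mul_div_assoc']
    refine div_le_div_of_nonneg_right ?_ (by positivity)
    have h2 := combinedNoiseVar_mul_sub_sq A w v b
    have h3 : (b * A + 1 - b) ^ 2 * (w * v) ≤ combinedNoiseVar w v b * (A ^ 2 * w + v) := by
      linarith [sq_nonneg ((1 - b) * (A * w) - b * v)]
    linarith [mul_le_mul_of_nonneg_right h3 hE.le]
  · rw [neg_sqrt_div_le_iff hw hv hA] at h1
    have h2 : 0 ≤ b * (1 - b) * (-A) * w := by
      have : 0 ≤ -A := by linarith
      positivity
    unfold combinedNoiseVar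
    linarith [mul_le_mul_of_nonneg_left h1 (sq_nonneg b)]
  · rw [le_neg_sqrt_div_iff hw] at h1
    have h2 : 0 ≤ b * (1 - b) * (-A) * v := by
      have : 0 ≤ -A := by linarith
      positivity
    unfold combinedNoiseVar
    linarith [mul_le_mul_of_nonneg_left h1.2 (sq_nonneg (1 - b))]

theorem exists_tableRow (A S w v : ℝ) : ∃ a K J, TableRow A S w v a K J := by
  rcases le_total 0 A with h | h
  · exact ⟨_, _, _, .inl ⟨h, rfl, rfl, rfl⟩⟩
  rcases le_total (-√(v / w)) A with h' | h'
  · exact ⟨_, _, _, .inr (.inl ⟨h', h, rfl, rfl, rfl⟩)⟩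
  · exact ⟨_, _, _, .inr (.inr ⟨h', rfl, rfl, rfl⟩)⟩

/-- Every minimiser of the posterior variance is a row of the table. -/
theorem exists_tableRow_of_forall_le {a : ℝ} (hw : 0 < w) (hv : 0 < v) (hS : 0 < S)
    (ha : a ∈ Set.Icc (0 : ℝ) 1)
    (hmin : ∀ b ∈ Set.Icc (0 : ℝ) 1, posteriorVar A w v S a ≤ posteriorVar A w v S b) :
    ∃ K J, TableRow A S w v a K J := by
  have ha1 : 0 ≤ 1 - a := sub_nonneg.2 ha.2
  have ha0 := ha.1
  rcases le_or_gt 0 A with hA | hA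
  · have hD : 0 < A * w + v := by positivity
    have hE : 0 < A ^ 2 * w + v := by positivity
    have hrow : TableRow A S w v (A * w / (A * w + v)) _ _ := .inl ⟨hA, rfl, rfl, rfl⟩
    have h := hmin _ (hrow.mem_Icc hw hv)
    rw [posteriorVar_le_iff hw hv hS, stateGain_optimal hD.ne' rfl,
      combinedNoiseVar_optimal hD.ne' rfl, div_pow, div_mul_eq_mul_div, mul_div_assoc',
      div_le_div_iff_of_pos_right (by positivity)] at h
    have h1 : (A ^ 2 * w + v) * (combinedNoiseVar w v a * (A ^ 2 * w + v)
        - (a * A + 1 - a) ^ 2 * (w * v)) ≤ 0 := by linarith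
    -- Being at least as good as the optimum forces the Cauchy–Schwarz defect to vanish, which
    -- determines `a`.
    rw [combinedNoiseVar_mul_sub_sq] at h1
    have h2 : ((1 - a) * (A * w) - a * v) ^ 2 ≤ 0 := by
      by_contra! hc
      linarith [mul_pos hE hc]
    have h3 := pow_eq_zero_iff two_ne_zero |>.1 (le_antisymm h2 (sq_nonneg _))
    refine ⟨_, _, .inl ⟨hA, ?_, rfl, rfl⟩⟩
    rw [eq_div_iff hD.ne']
    linarith
  rcases le_total (-√(v / w)) A with h' | h'
  · have h := hmin 0 (by simp)
    rw [posteriorVar_le_iff hw hv hS] at h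
    have h1 := (neg_sqrt_div_le_iff hw hv hA.le).1 h'
    rcases ha0.eq_or_lt with h0 | h0
    · exact ⟨_, _, .inr (.inl ⟨h', hA.le, h0.symm, rfl, rfl⟩)⟩
    have h2 : a ^ 2 * (v - A ^ 2 * w) + 2 * (a * (1 - a) * (-A) * w) ≤ 0 := by
      unfold combinedNoiseVar at h
      linarith
    have h3 : 0 ≤ a ^ 2 * (v - A ^ 2 * w) := mul_nonneg (sq_nonneg a) (sub_nonneg.2 h1)
    -- An interior `a` would make the cross term strictly positive. The endpoint `1` survives only
    -- if `A² w = v`, the overlap of the two rows; the other branch below is symmetric.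
    have h4 : a = 1 := by
      by_contra hne
      have : 0 < 1 - a := lt_of_le_of_ne ha1 (by intro h; apply hne; linarith)
      have : 0 < a * (1 - a) * (-A) * w := by
        have := neg_pos.2 hA
        positivity
      linarith
    subst h4
    exact ⟨_, _, .inr (.inr ⟨(le_neg_sqrt_div_iff hw).2 ⟨hA.le, by linarith⟩, rfl, rfl, rfl⟩)⟩
  · have h := hmin 1 (by simp)
    rw [posteriorVar_le_iff hw hv hS] at h
    have h1 := ((le_neg_sqrt_div_iff hw).1 h').2
    rcases ha1.eq_or_lt with h0 | h0
    · exact ⟨_, _, .inr (.inr ⟨h', by linarith, rfl, rfl⟩)⟩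
    have h2 : (1 - a) ^ 2 * (A ^ 2 * w - v) + 2 * (a * (1 - a) * (-A) * v) ≤ 0 := by
      unfold combinedNoiseVar at h
      linarith
    have h3 : 0 ≤ (1 - a) ^ 2 * (A ^ 2 * w - v) := mul_nonneg (sq_nonneg _) (sub_nonneg.2 h1)
    have h4 : a = 0 := by
      by_contra hne
      have : 0 < a := lt_of_le_of_ne ha0 (Ne.symm hne)
      have : 0 < a * (1 - a) * (-A) * v := by
        have := neg_pos.2 hA
        positivity
      linarith
    subst h4
    exact ⟨_, _, .inr (.inl
      ⟨(neg_sqrt_div_le_iff hw hv hA.le).2 (by linarith), hA.le, rfl, rfl, rfl⟩)⟩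

end GaussMarkovModel

/-! ### Independence of past and fresh noise, and the Kalman recursion by induction on time. -/

namespace GaussMarkovModel

variable {Ω : Type*} [MeasurableSpace Ω] {P : Measure Ω} {n : ℕ}

/-- All the independent noise sources, the initial state included. -/
def noise (M : GaussMarkovModel P n) :
    Unit ⊕ (Fin n ⊕ (Fin (n + 1) ⊕ Fin (n + 1))) → Ω → ℝ :=
  Sum.elim (fun _ : Unit => M.x0)
    (Sum.elim (fun t : Fin n => M.noiseN t)
      (Sum.elim (fun t : Fin (n + 1) => M.noiseW t) (fun t : Fin (n + 1) => M.noiseV t)))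

/-- Indices of the initial state, of the first `k` source noises and of the first `l` observation
and channel noises. -/
def pastIndex (n k l : ℕ) : Set (Unit ⊕ (Fin n ⊕ (Fin (n + 1) ⊕ Fin (n + 1)))) :=
  {i | Sum.elim (fun _ => True)
    (Sum.elim (fun s : Fin n => (s : ℕ) < k)
      (Sum.elim (fun s : Fin (n + 1) => (s : ℕ) < l) (fun s : Fin (n + 1) => (s : ℕ) < l))) i}

/-- The σ-algebra generated by the noise sources with indices in `T`. -/
abbrev noiseAlgebra (M : GaussMarkovModel P n)
    (T : Set (Unit ⊕ (Fin n ⊕ (Fin (n + 1) ⊕ Fin (n + 1))))) : MeasurableSpace Ω :=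
  ⨆ i ∈ T, MeasurableSpace.comap (M.noise i) inferInstance

/-- The combined noise `(1 - α_t) w_t + α_t v_t` in `r_t`. -/
def combinedNoise (M : GaussMarkovModel P n) (α : ℕ → ℝ) (t : ℕ) (ω : Ω) : ℝ :=
  (1 - α t) * M.noiseW t ω + α t * M.noiseV t ω

/-- The prediction variances as computed by the Riccati recursion. -/
noncomputable def riccati (M : GaussMarkovModel P n) (A α : ℕ → ℝ) : ℕ → ℝ
  | 0 => M.varX0
  | t + 1 => M.β t ^ 2 *
      posteriorVar (A t) (M.varW t) (M.varV t) (M.riccati A α t) (α t) + M.varN t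

variable (M : GaussMarkovModel P n) (A α : ℕ → ℝ)

theorem measurable_noise (i) : Measurable (M.noise i) := by
  rcases i with i | i | i | i
  · exact M.measurable_x0
  · exact M.measurable_noiseN i i.2
  · exact M.measurable_noiseW i (Nat.lt_succ_iff.1 i.2)
  · exact M.measurable_noiseV i (Nat.lt_succ_iff.1 i.2)

theorem measurable_noise_of_mem {T} {i} (hi : i ∈ T) : Measurable[M.noiseAlgebra T] (M.noise i) :=
  (comap_measurable (M.noise i)).mono (le_iSup₂_of_le i hi le_rfl) le_rfl

/-- Independence of past variables from fresh noise is reduced to disjointness of finite index sets.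
-/
theorem indepFun_of_disjoint {E F : Type*} [MeasurableSpace E] [MeasurableSpace F] {Y : Ω → E}
    {Z : Ω → F} {T U} (hTU : Disjoint T U) (hY : Measurable[M.noiseAlgebra T] Y)
    (hZ : Measurable[M.noiseAlgebra U] Z) : IndepFun Y Z P := by
  have h := indep_iSup_of_disjoint (fun i => (M.measurable_noise i).comap_le) M.indep hTU
  rw [IndepFun_iff_Indep]
  exact indep_of_indep_of_le_left (indep_of_indep_of_le_right h hZ.comap_le) hY.comap_le

theorem measurable_state_past {t k : ℕ} (l : ℕ) (htk : t ≤ k) (htn : t ≤ n) :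
    Measurable[M.noiseAlgebra (pastIndex n k l)] (M.state t) := by
  induction t with
  | zero => exact M.measurable_noise_of_mem (i := .inl ()) (by simp [pastIndex])
  | succ t ih =>
    have h : Measurable[M.noiseAlgebra (pastIndex n k l)] (M.noiseN t) :=
      M.measurable_noise_of_mem (i := .inr (.inl ⟨t, htn⟩)) (by simpa [pastIndex] using htk)
    exact ((ih (by omega) (by omega)).const_mul _).add h

theorem measurable_noiseW_past {t l : ℕ} (k : ℕ) (htl : t < l) (htn : t ≤ n) :
    Measurable[M.noiseAlgebra (pastIndex n k l)] (M.noiseW t) :=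
  M.measurable_noise_of_mem (i := .inr (.inr (.inl ⟨t, by omega⟩))) (by simpa [pastIndex] using htl)

theorem measurable_noiseV_past {t l : ℕ} (k : ℕ) (htl : t < l) (htn : t ≤ n) :
    Measurable[M.noiseAlgebra (pastIndex n k l)] (M.noiseV t) :=
  M.measurable_noise_of_mem (i := .inr (.inr (.inr ⟨t, by omega⟩))) (by simpa [pastIndex] using htl)

theorem received_eq (t : ℕ) (ω : Ω) :
    M.received (linearEncoder A) α t ω
      = stateGain A α t * M.state t ω + M.combinedNoise α t ω := by
  simp only [received, outY, outZ, linearEncoder, stateGain, combinedNoise]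
  ring

theorem measurable_received_past {t k l : ℕ} (htk : t ≤ k) (htl : t < l) (htn : t ≤ n) :
    Measurable[M.noiseAlgebra (pastIndex n k l)] (M.received (linearEncoder A) α t) := by
  rw [show M.received (linearEncoder A) α t
    = fun ω => stateGain A α t * M.state t ω
      + ((1 - α t) * M.noiseW t ω + α t * M.noiseV t ω) from funext (M.received_eq A α t)]
  exact ((M.measurable_state_past l htk htn).const_mul _).add
    (((M.measurable_noiseW_past k htl htn).const_mul _).add
      ((M.measurable_noiseV_past k htl htn).const_mul _))

/-- The first `t` inputs involve states only up to time `t - 1`, hence the bound `t ≤ k + 1`. -/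
theorem measurable_history_past {t k l : ℕ} (htk : t ≤ k + 1) (htl : t ≤ l) (htn : t ≤ n + 1) :
    Measurable[M.noiseAlgebra (pastIndex n k l)] (M.history (linearEncoder A) α t) :=
  @measurable_pi_lambda _ _ _ (M.noiseAlgebra (pastIndex n k l)) _ _ fun s =>
    M.measurable_received_past A α (by omega) (by omega) (by omega)

theorem indepFun_combinedNoise {E : Type*} [MeasurableSpace E] {Y : Ω → E} {t k : ℕ} (htn : t ≤ n)
    (hY : Measurable[M.noiseAlgebra (pastIndex n k t)] Y) :
    IndepFun Y (M.combinedNoise α t) P := by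
  let U : Set (Unit ⊕ (Fin n ⊕ (Fin (n + 1) ⊕ Fin (n + 1)))) :=
    {.inr (.inr (.inl ⟨t, by omega⟩)), .inr (.inr (.inr ⟨t, by omega⟩))}
  have hW : Measurable[M.noiseAlgebra U] (M.noiseW t) :=
    M.measurable_noise_of_mem (i := .inr (.inr (.inl ⟨t, by omega⟩))) (by simp [U])
  have hV : Measurable[M.noiseAlgebra U] (M.noiseV t) :=
    M.measurable_noise_of_mem (i := .inr (.inr (.inr ⟨t, by omega⟩))) (by simp [U])
  refine M.indepFun_of_disjoint (U := U) ?_ hY ((hW.const_mul _).add (hV.const_mul _))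
  rw [Set.disjoint_right]
  rintro i (rfl | rfl) <;> simp [pastIndex]

theorem indepFun_noiseN {E : Type*} [MeasurableSpace E] {Y : Ω → E} {t l : ℕ} (htn : t < n)
    (hY : Measurable[M.noiseAlgebra (pastIndex n t l)] Y) :
    IndepFun Y (M.noiseN t) P := by
  refine M.indepFun_of_disjoint (U := {.inr (.inl ⟨t, htn⟩)}) ?_ hY
    (M.measurable_noise_of_mem (i := .inr (.inl ⟨t, htn⟩)) (by simp))
  simp [pastIndex]

theorem indepFun_noiseW_noiseV {t : ℕ} (htn : t ≤ n) :
    IndepFun (M.noiseW t) (M.noiseV t) P :=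
  M.indep.indepFun (i := .inr (.inr (.inl ⟨t, by omega⟩)))
    (j := .inr (.inr (.inr ⟨t, by omega⟩))) (by simp)

theorem measurable_combinedNoise {t : ℕ} (htn : t ≤ n) : Measurable (M.combinedNoise α t) :=
  ((M.measurable_noiseW t htn).const_mul _).add ((M.measurable_noiseV t htn).const_mul _)

theorem hasGaussianLaw_combinedNoise {t : ℕ} (htn : t ≤ n) :
    HasGaussianLaw (M.combinedNoise α t) P := by
  have h := (M.indepFun_noiseW_noiseV htn).hasGaussianLaw (M.law_noiseW t htn).hasGaussianLaw
    (M.law_noiseV t htn).hasGaussianLaw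
  exact h.map_fun ((1 - α t) • ContinuousLinearMap.fst ℝ ℝ ℝ
    + (α t) • ContinuousLinearMap.snd ℝ ℝ ℝ)

theorem integral_combinedNoise {t : ℕ} (htn : t ≤ n) : ∫ ω, M.combinedNoise α t ω ∂P = 0 := by
  unfold combinedNoise
  rw [integral_add ((M.law_noiseW t htn).hasGaussianLaw.integrable.const_mul _)
    ((M.law_noiseV t htn).hasGaussianLaw.integrable.const_mul _), integral_const_mul,
    integral_const_mul, (M.law_noiseW t htn).integral_gaussianReal_zero,
    (M.law_noiseV t htn).integral_gaussianReal_zero]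
  simp

theorem variance_combinedNoise {t : ℕ} (htn : t ≤ n) :
    variance (M.combinedNoise α t) P = combinedNoiseVar (M.varW t) (M.varV t) (α t) := by
  have h := (M.indepFun_noiseW_noiseV htn).comp (φ := fun x => (1 - α t) * x)
    (ψ := fun x => α t * x) (by fun_prop) (by fun_prop)
  have h2 := h.variance_fun_add ((M.law_noiseW t htn).hasGaussianLaw.memLp_two.const_mul _)
    ((M.law_noiseV t htn).hasGaussianLaw.memLp_two.const_mul _)
  refine h2.trans ?_
  rw [variance_const_mul, variance_const_mul, (M.law_noiseW t htn).variance_gaussianReal,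
    (M.law_noiseV t htn).variance_gaussianReal, combinedNoiseVar]

theorem riccati_pos {t : ℕ} (htn : t ≤ n) : 0 < M.riccati A α t := by
  induction t with
  | zero => exact M.varX0_pos
  | succ t ih =>
    have h1 := posteriorVar_pos (M.varW_pos t (by omega)) (M.varV_pos t (by omega))
      (ih (by omega)) (A t) (α t)
    have h2 : (0 : ℝ) < M.varN t := M.varN_pos t htn
    unfold riccati
    positivity

/-- The prediction variance at `t` ignores `α t`, so a deviation at stage `t` leaves the scalar
problem of that stage unchanged. -/
theorem riccati_congr {α' : ℕ → ℝ} {t : ℕ} (h : ∀ s < t, α s = α' s) :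
    M.riccati A α t = M.riccati A α' t := by
  induction t with
  | zero => rfl
  | succ t ih =>
    simp only [riccati, h t (Nat.lt_succ_self t), ih fun s hs => h s (hs.trans (Nat.lt_succ_self t))]

theorem integrable_state {t : ℕ} (htn : t ≤ n) : Integrable (M.state t) P := by
  induction t with
  | zero => exact M.law_x0.hasGaussianLaw.integrable
  | succ t ih =>
    exact ((ih (by omega)).const_mul _).add (M.law_noiseN t htn).hasGaussianLaw.integrable

variable [IsProbabilityMeasure P]

/-- The measurement update of the Kalman filter. -/
theorem isGaussianPredictor_filter {t : ℕ} (htn : t ≤ n) {φ : (Fin t → ℝ) → ℝ}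
    (h : IsGaussianPredictor P (M.state t) (M.history (linearEncoder A) α t) φ
      (M.riccati A α t)) :
    IsGaussianPredictor P (M.state t) (M.history (linearEncoder A) α (t + 1))
      (fun y => φ (Fin.init y) + M.riccati A α t * stateGain A α t
        / innovationVar (A t) (M.varW t) (M.varV t) (M.riccati A α t) (α t)
          * (y (Fin.last t) - stateGain A α t * φ (Fin.init y)))
      (posteriorVar (A t) (M.varW t) (M.varV t) (M.riccati A α t) (α t)) := by
  have hpast : Measurable[M.noiseAlgebra (pastIndex n t t)]
      (M.history (linearEncoder A) α t) :=
    M.measurable_history_past A α (by omega) (by omega) (by omega)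
  have hind := M.indepFun_combinedNoise α (t := t) (k := t) htn
    (hpast.prodMk ((M.measurable_state_past t le_rfl htn).sub (h.measurable_map.comp hpast)))
  have hS := M.riccati_pos A α htn
  have hV := (innovationVar_pos (M.varW_pos t htn) (M.varV_pos t htn) hS.le (A t) (α t)).ne'
  -- `Fin.snoc` builds the longer history from the old one and the new input; `Fin.init` and
  -- evaluation at `Fin.last t` undo it.
  have hψ : Measurable fun z : (Fin t → ℝ) × ℝ => (Fin.snoc z.1 z.2 : Fin (t + 1) → ℝ) := by
    refine measurable_pi_lambda _ fun i => ?_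
    induction i using Fin.lastCases with
    | last => simpa using measurable_snd
    | cast i => simp only [Fin.snoc_castSucc]; fun_prop
  have hinit : Measurable fun y : Fin (t + 1) → ℝ => (Fin.init y : Fin t → ℝ) :=
    measurable_pi_lambda _ fun i => measurable_pi_apply _
  have key := h.update (M.measurable_combinedNoise α htn) (M.hasGaussianLaw_combinedNoise α htn)
    (M.integral_combinedNoise α htn) hind (stateGain A α t)
    (by rw [M.variance_combinedNoise α htn]; exact hV) (H' := M.history (linearEncoder A) α (t + 1))
    (r := fun y => y (Fin.last t)) hinit (by fun_prop) hψ
    (fun ω => by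
      rw [← M.received_eq]
      exact (Fin.snoc_init_self (M.history (linearEncoder A) α (t + 1) ω)).symm)
    (fun ω => rfl) (fun ω => by rw [← M.received_eq]; rfl)
  rw [M.variance_combinedNoise α htn] at key
  exact key

/-- The time update of the Kalman filter. -/
theorem isGaussianPredictor_succ {t : ℕ} (htn : t < n) {φ : (Fin (t + 1) → ℝ) → ℝ} {S : ℝ}
    (h : IsGaussianPredictor P (M.state t) (M.history (linearEncoder A) α (t + 1)) φ S) :
    IsGaussianPredictor P (M.state (t + 1)) (M.history (linearEncoder A) α (t + 1))
      (fun y => M.β t * φ y) (M.β t ^ 2 * S + M.varN t) := by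
  have hpast : Measurable[M.noiseAlgebra (pastIndex n t (t + 1))]
      (M.history (linearEncoder A) α (t + 1)) :=
    M.measurable_history_past A α (by omega) (by omega) (by omega)
  have hind := M.indepFun_noiseN (t := t) (l := t + 1) htn
    (hpast.prodMk ((M.measurable_state_past _ le_rfl htn.le).sub (h.measurable_map.comp hpast)))
  have key := h.affine (M.measurable_noiseN t htn) (M.law_noiseN t htn).hasGaussianLaw
    (M.law_noiseN t htn).integral_gaussianReal_zero hind (M.β t)
  rw [(M.law_noiseN t htn).variance_gaussianReal] at key
  exact key

theorem isGaussianPredictor_zero :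
    IsGaussianPredictor P (M.state 0) (M.history (linearEncoder A) α 0) (fun _ => 0)
      M.varX0 where
  measurable_target := M.measurable_x0
  measurable_obs := measurable_pi_lambda _ fun i => i.elim0
  measurable_map := measurable_const
  hasGaussianLaw := by simpa only [sub_zero] using! M.law_x0.hasGaussianLaw
  integral_eq_zero := by simpa only [sub_zero] using! M.law_x0.integral_gaussianReal_zero
  variance_eq := by simpa only [sub_zero] using! M.law_x0.variance_gaussianReal
  indep := by
    rw [show M.history (linearEncoder A) α 0 = fun _ => default from
      funext fun ω => Subsingleton.elim _ _]
    exact indepFun_const_left _ _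

theorem exists_isGaussianPredictor {t : ℕ} (htn : t ≤ n) :
    ∃ φ, IsGaussianPredictor P (M.state t) (M.history (linearEncoder A) α t) φ
      (M.riccati A α t) := by
  induction t with
  | zero => exact ⟨_, M.isGaussianPredictor_zero A α⟩
  | succ t ih =>
    obtain ⟨φ, h⟩ := ih (by omega)
    exact ⟨_, M.isGaussianPredictor_succ A α htn (M.isGaussianPredictor_filter A α (by omega) h)⟩

end GaussMarkovModel

/-! ### Solutions of the table along the Riccati recursion. -/

namespace GaussMarkovModel

section Table

variable {A S w v a K J : ℝ}

/-- Neither the case distinction nor the combining parameter involves the prediction variance. -/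
theorem TableRow.exists_row (h : TableRow A S w v a K J) (S' : ℝ) :
    ∃ K' J', TableRow A S' w v a K' J' := by
  rcases h with ⟨h1, h2, -⟩ | ⟨h1, h2, h3, -⟩ | ⟨h1, h2, -⟩
  · exact ⟨_, _, .inl ⟨h1, h2, rfl, rfl⟩⟩
  · exact ⟨_, _, .inr (.inl ⟨h1, h2, h3, rfl, rfl⟩)⟩
  · exact ⟨_, _, .inr (.inr ⟨h1, h2, rfl, rfl⟩)⟩

theorem tableRow_of_forall_le (hw : 0 < w) (hv : 0 < v) (hS : 0 < S)
    (ha : a ∈ Set.Icc (0 : ℝ) 1)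
    (hmin : ∀ b ∈ Set.Icc (0 : ℝ) 1, posteriorVar A w v S a ≤ posteriorVar A w v S b) :
    TableRow A S w v a (S * (a * A + 1 - a) / innovationVar A w v S a)
      (posteriorVar A w v S a) := by
  obtain ⟨K, J, h⟩ := exists_tableRow_of_forall_le hw hv hS ha hmin
  rwa [← h.gain_eq hw hv hS, ← h.cost_eq hw hv hS]

end Table

variable {Ω : Type*} [MeasurableSpace Ω] {P : Measure Ω} {n : ℕ}

/-- The filtering error variance at stage `t` when the last combining parameter is `a`. -/
noncomputable def riccatiFilter (M : GaussMarkovModel P n) (A α : ℕ → ℝ) (t : ℕ) (a : ℝ) : ℝ :=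
  posteriorVar (A t) (M.varW t) (M.varV t) (M.riccati A α t) a

variable (M : GaussMarkovModel P n) (A α : ℕ → ℝ)

theorem riccatiFilter_pos {t : ℕ} (htn : t ≤ n) (a : ℝ) : 0 < M.riccatiFilter A α t a :=
  posteriorVar_pos (M.varW_pos t htn) (M.varV_pos t htn) (M.riccati_pos A α htn) _ _

theorem riccatiFilter_update (t : ℕ) (a b : ℝ) :
    M.riccatiFilter A (Function.update α t a) t b = M.riccatiFilter A α t b := by
  rw [riccatiFilter, riccatiFilter, M.riccati_congr A (Function.update α t a) (α' := α)
    fun s hs => Function.update_of_ne hs.ne _ _]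

section Table

variable {M A α} {K J S : ℕ → ℝ}

theorem SolvesTable.eq_riccati (h : M.SolvesTable A α K J S) {t : ℕ} (htn : t ≤ n) :
    S t = M.riccati A α t := by
  induction t with
  | zero => exact h.1
  | succ t ih =>
    have ht : t ≤ n := by omega
    have hrow := h.2.2 t ht
    rw [ih ht] at hrow
    rw [h.2.1 t htn, hrow.cost_eq (M.varW_pos t ht) (M.varV_pos t ht) (M.riccati_pos A α ht)]
    rfl

theorem SolvesTable.tableRow (h : M.SolvesTable A α K J S) {t : ℕ} (htn : t ≤ n) :
    TableRow (A t) (M.riccati A α t) (M.varW t) (M.varV t) (α t) (K t) (J t) :=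
  h.eq_riccati htn ▸ h.2.2 t htn

theorem SolvesTable.mem_Icc (h : M.SolvesTable A α K J S) {t : ℕ} (htn : t ≤ n) :
    α t ∈ Set.Icc (0 : ℝ) 1 :=
  (h.tableRow htn).mem_Icc (M.varW_pos t htn) (M.varV_pos t htn)

theorem SolvesTable.cost_eq (h : M.SolvesTable A α K J S) {t : ℕ} (htn : t ≤ n) :
    J t = M.riccatiFilter A α t (α t) :=
  (h.tableRow htn).cost_eq (M.varW_pos t htn) (M.varV_pos t htn) (M.riccati_pos A α htn)

theorem SolvesTable.riccatiFilter_le (h : M.SolvesTable A α K J S) {t : ℕ} (htn : t ≤ n) {b : ℝ}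
    (hb : b ∈ Set.Icc (0 : ℝ) 1) : M.riccatiFilter A α t (α t) ≤ M.riccatiFilter A α t b :=
  (h.tableRow htn).posteriorVar_le (M.varW_pos t htn) (M.varV_pos t htn) (M.riccati_pos A α htn) hb

/-- The solutions of the table minimise the error variance at all stages simultaneously. -/
theorem SolvesTable.riccati_le (h : M.SolvesTable A α K J S) {α' : ℕ → ℝ}
    (hα' : ∀ t ≤ n, α' t ∈ Set.Icc (0 : ℝ) 1) {t : ℕ} (htn : t ≤ n) :
    M.riccati A α t ≤ M.riccati A α' t ∧
      M.riccatiFilter A α t (α t) ≤ M.riccatiFilter A α' t (α' t) := by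
  -- Two comparisons are chained: the table's parameter beats `α' t` at the same prediction
  -- variance, and `posteriorVar` is monotone in that variance.
  have step {t : ℕ} (htn : t ≤ n) (hle : M.riccati A α t ≤ M.riccati A α' t) :
      M.riccatiFilter A α t (α t) ≤ M.riccatiFilter A α' t (α' t) :=
    (h.riccatiFilter_le htn (hα' t htn)).trans
      (posteriorVar_mono (M.varW_pos t htn) (M.varV_pos t htn) (M.riccati_pos A α htn).le hle _ _)
  induction t with
  | zero => exact ⟨le_rfl, step htn le_rfl⟩
  | succ t ih =>
    have hle : M.riccati A α (t + 1) ≤ M.riccati A α' (t + 1) := by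
      have := mul_le_mul_of_nonneg_left (ih (by omega)).2 (sq_nonneg (M.β t))
      simpa only [riccati, add_le_add_iff_right] using! this
    exact ⟨hle, step htn hle⟩

theorem exists_solvesTable_of_forall_le (hα : ∀ t ≤ n, α t ∈ Set.Icc (0 : ℝ) 1 ∧
      ∀ b ∈ Set.Icc (0 : ℝ) 1, M.riccatiFilter A α t (α t) ≤ M.riccatiFilter A α t b) :
    ∃ K J S, M.SolvesTable A α K J S :=
  ⟨_, _, M.riccati A α, rfl, fun _ _ => rfl, fun t ht =>
    tableRow_of_forall_le (M.varW_pos t ht) (M.varV_pos t ht) (M.riccati_pos A α ht)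
      (hα t ht).1 (hα t ht).2⟩

variable (M A) in
theorem exists_solvesTable : ∃ α K J S, M.SolvesTable A α K J S := by
  choose α K J h using fun t => exists_tableRow (A t) 1 (M.varW t) (M.varV t)
  refine ⟨α, exists_solvesTable_of_forall_le fun t ht => ?_⟩
  have hw := M.varW_pos t ht
  have hv := M.varV_pos t ht
  refine ⟨(h t).mem_Icc hw hv, fun b hb => ?_⟩
  obtain ⟨K', J', h'⟩ := (h t).exists_row (M.riccati A α t)
  exact h'.posteriorVar_le hw hv (M.riccati_pos A α ht) hb

end Table

/-! ### Conditional means, innovations and gains expressed through the Riccati recursion. -/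

theorem integrable_received {t : ℕ} (htn : t ≤ n) :
    Integrable (M.received (linearEncoder A) α t) P := by
  rw [funext (M.received_eq A α t)]
  exact ((M.integrable_state htn).const_mul _).add
    (M.hasGaussianLaw_combinedNoise α htn).integrable

variable [IsProbabilityMeasure P]

theorem predVar_eq {t : ℕ} (htn : t ≤ n) :
    M.predVar (linearEncoder A) α t = M.riccati A α t := by
  obtain ⟨φ, h⟩ := M.exists_isGaussianPredictor A α htn
  exact h.integral_sq_sub_condExp (M.integrable_state htn)

theorem predCondVar_ae_eq {t : ℕ} (htn : t ≤ n) :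
    M.predCondVar (linearEncoder A) α t =ᵐ[P] fun _ => M.predVar (linearEncoder A) α t := by
  obtain ⟨φ, h⟩ := M.exists_isGaussianPredictor A α htn
  rw [M.predVar_eq A α htn]
  exact h.condExp_sq_sub_condExp (M.integrable_state htn)

theorem exists_isGaussianPredictor_filter {t : ℕ} (htn : t ≤ n) :
    ∃ φ, IsGaussianPredictor P (M.state t) (M.history (linearEncoder A) α (t + 1)) φ
      (M.riccatiFilter A α t (α t)) :=
  let ⟨_, h⟩ := M.exists_isGaussianPredictor A α htn
  ⟨_, M.isGaussianPredictor_filter A α htn h⟩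

theorem filtVar_eq {t : ℕ} (htn : t ≤ n) :
    M.filtVar (linearEncoder A) α t = M.riccatiFilter A α t (α t) := by
  obtain ⟨φ, h⟩ := M.exists_isGaussianPredictor_filter A α htn
  exact h.integral_sq_sub_condExp (M.integrable_state htn)

theorem filtCondVar_ae_eq {t : ℕ} (htn : t ≤ n) :
    M.filtCondVar (linearEncoder A) α t =ᵐ[P] fun _ => M.filtVar (linearEncoder A) α t := by
  obtain ⟨φ, h⟩ := M.exists_isGaussianPredictor_filter A α htn
  rw [M.filtVar_eq A α htn]
  exact h.condExp_sq_sub_condExp (M.integrable_state htn)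

theorem predMean_zero_ae_eq : M.predMean (linearEncoder A) α 0 =ᵐ[P] fun _ => 0 :=
  (M.isGaussianPredictor_zero A α).condExp_eq (M.integrable_state (Nat.zero_le n))

theorem predMean_succ_ae_eq {t : ℕ} (htn : t < n) :
    M.predMean (linearEncoder A) α (t + 1)
      =ᵐ[P] fun ω => M.β t * M.filtMean (linearEncoder A) α t ω := by
  obtain ⟨φ, h⟩ := M.exists_isGaussianPredictor_filter A α htn.le
  filter_upwards [h.condExp_eq (M.integrable_state htn.le),
    (M.isGaussianPredictor_succ A α htn h).condExp_eq (M.integrable_state htn)] with ω h1 h2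
  rw [predMean, filtMean, h1, h2]

/-- Prediction of the next input of the decoder. -/
theorem isGaussianPredictor_received {t : ℕ} (htn : t ≤ n) {φ : (Fin t → ℝ) → ℝ}
    (h : IsGaussianPredictor P (M.state t) (M.history (linearEncoder A) α t) φ
      (M.riccati A α t)) :
    IsGaussianPredictor P (M.received (linearEncoder A) α t) (M.history (linearEncoder A) α t)
      (fun y => stateGain A α t * φ y)
      (innovationVar (A t) (M.varW t) (M.varV t) (M.riccati A α t) (α t)) := by
  have hpast : Measurable[M.noiseAlgebra (pastIndex n t t)] (M.history (linearEncoder A) α t) :=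
    M.measurable_history_past A α (by omega) (by omega) (by omega)
  have key := h.affine (M.measurable_combinedNoise α htn) (M.hasGaussianLaw_combinedNoise α htn)
    (M.integral_combinedNoise α htn) (M.indepFun_combinedNoise α (k := t) htn
    (hpast.prodMk ((M.measurable_state_past t le_rfl htn).sub (h.measurable_map.comp hpast))))
    (stateGain A α t)
  rw [M.variance_combinedNoise α htn, ← funext (M.received_eq A α t)] at key
  exact key

theorem innovation_ae_eq {t : ℕ} (htn : t ≤ n) :
    M.innovation (linearEncoder A) α t =ᵐ[P] fun ω => M.received (linearEncoder A) α t ω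
      - stateGain A α t * M.predMean (linearEncoder A) α t ω := by
  obtain ⟨φ, h⟩ := M.exists_isGaussianPredictor A α htn
  filter_upwards [h.condExp_eq (M.integrable_state htn),
    (M.isGaussianPredictor_received A α htn h).condExp_eq (M.integrable_received A α htn)]
    with ω h1 h2
  rw [innovation, predMean, h1, h2]

theorem variance_innovation {t : ℕ} (htn : t ≤ n) :
    variance (M.innovation (linearEncoder A) α t) P
      = innovationVar (A t) (M.varW t) (M.varV t) (M.riccati A α t) (α t) := by
  obtain ⟨φ, h⟩ := M.exists_isGaussianPredictor A α htn
  rw [← (M.isGaussianPredictor_received A α htn h).variance_eq]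
  refine variance_congr ?_
  filter_upwards [h.condExp_eq (M.integrable_state htn), M.innovation_ae_eq A α htn] with ω h1 h2
  rw [h2, predMean, h1]

theorem kalmanGain_eq {t : ℕ} (htn : t ≤ n) :
    M.kalmanGain A α t = M.riccati A α t * stateGain A α t
      / innovationVar (A t) (M.varW t) (M.varV t) (M.riccati A α t) (α t) := by
  rw [kalmanGain, M.predVar_eq A α htn, M.variance_innovation A α htn]

theorem filtMean_ae_eq {t : ℕ} (htn : t ≤ n) :
    M.filtMean (linearEncoder A) α t =ᵐ[P] fun ω => M.predMean (linearEncoder A) α t ω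
      + M.kalmanGain A α t * (M.received (linearEncoder A) α t ω
        - stateGain A α t * M.predMean (linearEncoder A) α t ω) := by
  obtain ⟨φ, h⟩ := M.exists_isGaussianPredictor A α htn
  filter_upwards [h.condExp_eq (M.integrable_state htn),
    (M.isGaussianPredictor_filter A α htn h).condExp_eq (M.integrable_state htn)] with ω h1 h2
  rw [filtMean, predMean, h1, h2, M.kalmanGain_eq A α htn]
  rfl

/-! ### Stage costs, forward optimality and the average cost. -/

theorem mse_filtMean {t : ℕ} (htn : t ≤ n) :
    mse P (M.state t) (M.filtMean (linearEncoder A) α t)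
      = ENNReal.ofReal (M.riccatiFilter A α t (α t)) := by
  obtain ⟨φ, h⟩ := M.exists_isGaussianPredictor_filter A α htn
  exact h.mse_condExp (M.integrable_state htn)

theorem le_stageCost {t : ℕ} (htn : t ≤ n) {g : (Fin (t + 1) → ℝ) → ℝ} (hg : Measurable g) :
    ENNReal.ofReal (M.riccatiFilter A α t (α t)) ≤ M.stageCost (linearEncoder A) α t g := by
  obtain ⟨φ, h⟩ := M.exists_isGaussianPredictor_filter A α htn
  exact h.le_mse hg

theorem stageCost_eq_iff {t : ℕ} (htn : t ≤ n) {g : (Fin (t + 1) → ℝ) → ℝ} (hg : Measurable g) :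
    M.stageCost (linearEncoder A) α t g = ENNReal.ofReal (M.riccatiFilter A α t (α t)) ↔
      (fun ω => g (M.history (linearEncoder A) α (t + 1) ω))
        =ᵐ[P] M.filtMean (linearEncoder A) α t := by
  obtain ⟨φ, h⟩ := M.exists_isGaussianPredictor_filter A α htn
  have h1 := h.condExp_eq (M.integrable_state htn)
  exact (h.mse_eq_iff hg).trans ⟨fun h2 => h2.trans h1.symm, fun h2 => h2.trans h1⟩

theorem exists_stageCost_eq {t : ℕ} (htn : t ≤ n) :
    ∃ g, Measurable g ∧ M.stageCost (linearEncoder A) α t g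
      = ENNReal.ofReal (M.riccatiFilter A α t (α t)) := by
  obtain ⟨φ, h⟩ := M.exists_isGaussianPredictor_filter A α htn
  exact ⟨φ, h.measurable_map, (h.mse_eq_iff h.measurable_map).2 .rfl⟩

theorem le_stageCost_update {t : ℕ} (htn : t ≤ n) (a : ℝ) {g : (Fin (t + 1) → ℝ) → ℝ}
    (hg : Measurable g) : ENNReal.ofReal (M.riccatiFilter A α t a)
      ≤ M.stageCost (linearEncoder A) (Function.update α t a) t g := by
  simpa only [Function.update_self, riccatiFilter_update] using
    M.le_stageCost A (Function.update α t a) htn hg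

theorem exists_stageCost_update_eq {t : ℕ} (htn : t ≤ n) (a : ℝ) :
    ∃ g, Measurable g ∧ M.stageCost (linearEncoder A) (Function.update α t a) t g
      = ENNReal.ofReal (M.riccatiFilter A α t a) := by
  simpa only [Function.update_self, riccatiFilter_update] using
    M.exists_stageCost_eq A (Function.update α t a) htn

/-- Forward optimality decouples: the parameter minimises a scalar function, and the estimator
attains the resulting least error. Every scalar value is realised by some measurable estimator, so
the two minimisations can be separated. -/
theorem isForwardOptimal_iff {γ : (t : ℕ) → (Fin (t + 1) → ℝ) → ℝ} :
    M.IsForwardOptimal (linearEncoder A) α γ ↔ ∀ t ≤ n,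
      (α t ∈ Set.Icc (0 : ℝ) 1 ∧ Measurable (γ t)) ∧
      (∀ b ∈ Set.Icc (0 : ℝ) 1, M.riccatiFilter A α t (α t) ≤ M.riccatiFilter A α t b) ∧
      M.stageCost (linearEncoder A) α t (γ t)
        = ENNReal.ofReal (M.riccatiFilter A α t (α t)) := by
  refine ⟨fun h t ht => ⟨h.1 t ht, fun b hb => ?_, le_antisymm ?_ ?_⟩,
    fun h => ⟨fun t ht => (h t ht).1, fun t ht b hb g hg => ?_⟩⟩
  · obtain ⟨g, hg, hgb⟩ := M.exists_stageCost_update_eq A α ht b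
    have h1 := (M.le_stageCost A α ht (h.1 t ht).2).trans (h.2 t ht b hb g hg)
    rwa [hgb, ENNReal.ofReal_le_ofReal_iff (M.riccatiFilter_pos A α ht b).le] at h1
  · obtain ⟨g, hg, hga⟩ := M.exists_stageCost_update_eq A α ht (α t)
    exact hga ▸ h.2 t ht _ (h.1 t ht).1 g hg
  · exact M.le_stageCost A α ht (h.1 t ht).2
  · obtain ⟨-, h1, h2⟩ := h t ht
    exact h2.trans_le ((ENNReal.ofReal_le_ofReal (h1 b hb)).trans
      (M.le_stageCost_update A α ht b hg))

theorem exists_estimators : ∃ γ : (t : ℕ) → (Fin (t + 1) → ℝ) → ℝ, ∀ t ≤ n, Measurable (γ t) ∧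
    M.stageCost (linearEncoder A) α t (γ t)
      = ENNReal.ofReal (M.riccatiFilter A α t (α t)) := by
  have h (t : ℕ) : ∃ g : (Fin (t + 1) → ℝ) → ℝ, t ≤ n → Measurable g ∧
      M.stageCost (linearEncoder A) α t g
        = ENNReal.ofReal (M.riccatiFilter A α t (α t)) := by
    by_cases ht : t ≤ n
    · obtain ⟨g, hg⟩ := M.exists_stageCost_eq A α ht
      exact ⟨g, fun _ => hg⟩
    · exact ⟨0, fun h => absurd h ht⟩
  choose γ hγ using h
  exact ⟨γ, hγ⟩

variable {M A α}

theorem SolvesTable.gain_eq {K J S : ℕ → ℝ} (h : M.SolvesTable A α K J S) {t : ℕ} (htn : t ≤ n) :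
    K t = M.kalmanGain A α t := by
  rw [M.kalmanGain_eq A α htn]
  exact (h.tableRow htn).gain_eq (M.varW_pos t htn) (M.varV_pos t htn) (M.riccati_pos A α htn)

theorem SolvesTable.isLeast_stageCost {K J S : ℕ → ℝ} (h : M.SolvesTable A α K J S) {t : ℕ}
    (htn : t ≤ n) :
    IsLeast {c : ℝ≥0∞ | ∃ a ∈ Set.Icc (0 : ℝ) 1, ∃ g : (Fin (t + 1) → ℝ) → ℝ,
      Measurable g ∧ c = M.stageCost (linearEncoder A) (Function.update α t a) t g}
      (ENNReal.ofReal (J t)) := by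
  rw [h.cost_eq htn]
  refine ⟨?_, ?_⟩
  · obtain ⟨g, hg, hga⟩ := M.exists_stageCost_update_eq A α htn (α t)
    exact ⟨α t, h.mem_Icc htn, g, hg, hga.symm⟩
  · rintro c ⟨a, ha, g, hg, rfl⟩
    exact (ENNReal.ofReal_le_ofReal (h.riccatiFilter_le htn ha)).trans
      (M.le_stageCost_update A α htn a hg)

/-- The sum is bounded term by term, since a solution of the table is best at every stage against
all admissible parameter sequences, not only against deviations at that stage. -/
theorem SolvesTable.isLeast_averageCost {K J S : ℕ → ℝ} (h : M.SolvesTable A α K J S) :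
    IsLeast {c : ℝ≥0∞ | ∃ (α' : ℕ → ℝ) (γ : (t : ℕ) → (Fin (t + 1) → ℝ) → ℝ),
        Admissible n α' γ ∧ c = M.averageCost (linearEncoder A) α' γ}
      (ENNReal.ofReal (1 / ((n : ℝ) + 1) * ∑ t ∈ Finset.range (n + 1), J t)) := by
  have hJ {t : ℕ} (ht : t ∈ Finset.range (n + 1)) : t ≤ n :=
    Nat.lt_succ_iff.1 (Finset.mem_range.1 ht)
  have hsum : ENNReal.ofReal (1 / ((n : ℝ) + 1) * ∑ t ∈ Finset.range (n + 1), J t)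
      = (∑ t ∈ Finset.range (n + 1), ENNReal.ofReal (M.riccatiFilter A α t (α t)))
        / ((n : ℝ≥0∞) + 1) := by
    rw [one_div_mul_eq_div, ENNReal.ofReal_div_of_pos (by positivity), Finset.sum_congr rfl
      fun t ht => h.cost_eq (hJ ht), ENNReal.ofReal_sum_of_nonneg
      fun t ht => (M.riccatiFilter_pos A α (hJ ht) _).le]
    congr 1
    rw [ENNReal.ofReal_add (by positivity) (by positivity)]
    simp
  rw [hsum]
  refine ⟨?_, ?_⟩
  · obtain ⟨γ, hγ⟩ := M.exists_estimators A α
    refine ⟨α, γ, fun t ht => ⟨h.mem_Icc ht, (hγ t ht).1⟩, ?_⟩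
    rw [averageCost, Finset.sum_congr rfl fun t ht => (hγ t (hJ ht)).2]
  · rintro c ⟨α', γ, had, rfl⟩
    refine ENNReal.div_le_div_right (Finset.sum_le_sum fun t ht => ?_) _
    exact (ENNReal.ofReal_le_ofReal (h.riccati_le (fun s hs => (had s hs).1) (hJ ht)).2).trans
      (M.le_stageCost A α' (hJ ht) (had t (hJ ht)).2)

end GaussMarkovModel

theorem mainTheorem7 {Ω : Type*} [MeasurableSpace Ω] (P : Measure Ω) [IsProbabilityMeasure P]
    (n : ℕ) (M : GaussMarkovModel P n) (A : ℕ → ℝ) :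
    -- For all combining parameters: the Kalman filter recursions and optimality of the filter.
    (∀ α : ℕ → ℝ, (∀ t ≤ n, α t ∈ Set.Icc (0 : ℝ) 1) →
      (M.predMean (linearEncoder A) α 0 =ᵐ[P] fun _ => 0) ∧
      M.predVar (linearEncoder A) α 0 = M.varX0 ∧
      (∀ t < n,
        (M.predMean (linearEncoder A) α (t + 1)
          =ᵐ[P] fun ω => M.β t * M.filtMean (linearEncoder A) α t ω) ∧
        M.predVar (linearEncoder A) α (t + 1)
          = M.β t ^ 2 * M.filtVar (linearEncoder A) α t + M.varN t) ∧
      ∀ t ≤ n,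
        (M.predCondVar (linearEncoder A) α t
          =ᵐ[P] fun _ => M.predVar (linearEncoder A) α t) ∧
        (M.filtCondVar (linearEncoder A) α t
          =ᵐ[P] fun _ => M.filtVar (linearEncoder A) α t) ∧
        (M.innovation (linearEncoder A) α t
          =ᵐ[P] fun ω =>
            stateGain A α t * (M.state t ω - M.predMean (linearEncoder A) α t ω)
              + (1 - α t) * M.noiseW t ω + α t * M.noiseV t ω) ∧
        variance (M.innovation (linearEncoder A) α t) P
          = stateGain A α t ^ 2 * M.predVar (linearEncoder A) α t
            + (1 - α t) ^ 2 * M.varW t + α t ^ 2 * M.varV t ∧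
        0 < variance (M.innovation (linearEncoder A) α t) P ∧
        (M.filtMean (linearEncoder A) α t
          =ᵐ[P] fun ω => M.predMean (linearEncoder A) α t ω
            + M.kalmanGain A α t * M.innovation (linearEncoder A) α t ω) ∧
        (M.filtMean (linearEncoder A) α t
          =ᵐ[P] fun ω => M.predMean (linearEncoder A) α t ω
            + M.kalmanGain A α t * (M.received (linearEncoder A) α t ω
                - stateGain A α t * M.predMean (linearEncoder A) α t ω)) ∧
        M.filtVar (linearEncoder A) α t
          = (1 - M.kalmanGain A α t * stateGain A α t) * M.predVar (linearEncoder A) α t ∧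
        mse P (M.state t) (M.filtMean (linearEncoder A) α t)
          = ENNReal.ofReal (M.filtVar (linearEncoder A) α t) ∧
        ∀ g : (Fin (t + 1) → ℝ) → ℝ, Measurable g →
          mse P (M.state t) (M.filtMean (linearEncoder A) α t)
            ≤ M.stageCost (linearEncoder A) α t g ∧
          (M.stageCost (linearEncoder A) α t g
              = mse P (M.state t) (M.filtMean (linearEncoder A) α t) ↔
            (fun ω => g (M.history (linearEncoder A) α (t + 1) ω))
              =ᵐ[P] M.filtMean (linearEncoder A) α t)) ∧
    -- A forward-in-time optimal decoder exists.
    (∃ (α : ℕ → ℝ) (γ : (t : ℕ) → (Fin (t + 1) → ℝ) → ℝ),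
      M.IsForwardOptimal (linearEncoder A) α γ) ∧
    -- The optimal decoders are exactly the Kalman filters given by the table.
    (∀ (α : ℕ → ℝ) (γ : (t : ℕ) → (Fin (t + 1) → ℝ) → ℝ), (∀ t ≤ n, Measurable (γ t)) →
      (M.IsForwardOptimal (linearEncoder A) α γ ↔
        ∃ K J S : ℕ → ℝ, M.SolvesTable A α K J S ∧
          ∀ t ≤ n, (fun ω => γ t (M.history (linearEncoder A) α (t + 1) ω))
            =ᵐ[P] fun ω => M.predMean (linearEncoder A) α t ω
              + K t * (M.received (linearEncoder A) α t ω
                  - stateGain A α t * M.predMean (linearEncoder A) α t ω))) ∧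
    -- The entries of the table are the prediction variance, the Kalman gain and the optimal costs.
    (∀ α K J S : ℕ → ℝ, M.SolvesTable A α K J S →
      (∀ t ≤ n,
        α t ∈ Set.Icc (0 : ℝ) 1 ∧
        S t = M.predVar (linearEncoder A) α t ∧
        K t = M.kalmanGain A α t ∧
        J t = M.filtVar (linearEncoder A) α t ∧
        IsLeast {c : ℝ≥0∞ | ∃ a ∈ Set.Icc (0 : ℝ) 1, ∃ g : (Fin (t + 1) → ℝ) → ℝ,
            Measurable g ∧ c = M.stageCost (linearEncoder A) (Function.update α t a) t g}
          (ENNReal.ofReal (J t))) ∧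
      IsLeast {c : ℝ≥0∞ | ∃ (α' : ℕ → ℝ) (γ : (t : ℕ) → (Fin (t + 1) → ℝ) → ℝ),
          GaussMarkovModel.Admissible n α' γ ∧ c = M.averageCost (linearEncoder A) α' γ}
        (ENNReal.ofReal (1 / ((n : ℝ) + 1) * ∑ t ∈ Finset.range (n + 1), J t))) := by
  refine ⟨fun α hα => ⟨M.predMean_zero_ae_eq A α, M.predVar_eq A α (Nat.zero_le n),
    fun t ht => ⟨M.predMean_succ_ae_eq A α ht, ?_⟩, fun t ht => ?_⟩, ?_, fun α γ hγ => ?_,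
    fun α K J S h => ⟨fun t ht => ⟨h.mem_Icc ht, ?_, h.gain_eq ht, ?_, h.isLeast_stageCost ht⟩,
      h.isLeast_averageCost⟩⟩
  · rw [M.predVar_eq A α ht, M.filtVar_eq A α ht.le]
    rfl
  · have hinn := M.innovation_ae_eq A α ht
    have hvar := M.variance_innovation A α ht
    refine ⟨M.predCondVar_ae_eq A α ht, M.filtCondVar_ae_eq A α ht, ?_, ?_, ?_, ?_,
      M.filtMean_ae_eq A α ht, ?_, ?_, fun g hg => ⟨?_, ?_⟩⟩
    · filter_upwards [hinn] with ω h
      rw [h, M.received_eq, GaussMarkovModel.combinedNoise]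
      ring
    · rw [hvar, M.predVar_eq A α ht, innovationVar, combinedNoiseVar, add_assoc]
      rfl
    · rw [hvar]
      exact innovationVar_pos (M.varW_pos t ht) (M.varV_pos t ht) (M.riccati_pos A α ht).le _ _
    · filter_upwards [M.filtMean_ae_eq A α ht, hinn] with ω h1 h2
      rw [h1, h2]
    · rw [M.filtVar_eq A α ht, M.kalmanGain_eq A α ht, M.predVar_eq A α ht]
      rfl
    · rw [M.filtVar_eq A α ht, M.mse_filtMean A α ht]
    · rw [M.mse_filtMean A α ht]
      exact M.le_stageCost A α ht hg
    · rw [M.mse_filtMean A α ht]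
      exact M.stageCost_eq_iff A α ht hg
  · obtain ⟨α, K, J, S, h⟩ := M.exists_solvesTable A
    obtain ⟨γ, hγ⟩ := M.exists_estimators A α
    exact ⟨α, γ, (M.isForwardOptimal_iff A α).2 fun t ht => ⟨⟨h.mem_Icc ht, (hγ t ht).1⟩,
      fun b hb => h.riccatiFilter_le ht hb, (hγ t ht).2⟩⟩
  · rw [M.isForwardOptimal_iff A α]
    refine ⟨fun h => ?_, fun ⟨K, J, S, h, hae⟩ t ht => ⟨⟨h.mem_Icc ht, hγ t ht⟩,
      fun b hb => h.riccatiFilter_le ht hb, ?_⟩⟩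
    -- The scalar minimality of each `α t` yields the table; uniqueness of the optimal estimator
    -- then identifies `γ t` with the Kalman filter.
    · obtain ⟨K, J, S, hK⟩ := GaussMarkovModel.exists_solvesTable_of_forall_le
        fun t ht => ⟨(h t ht).1.1, (h t ht).2.1⟩
      refine ⟨K, J, S, hK, fun t ht => ?_⟩
      rw [hK.gain_eq ht]
      exact ((M.stageCost_eq_iff A α ht (hγ t ht)).1 (h t ht).2.2).trans (M.filtMean_ae_eq A α ht)
    · rw [M.stageCost_eq_iff A α ht (hγ t ht)]
      refine (hae t ht).trans ?_
      rw [h.gain_eq ht]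
      exact (M.filtMean_ae_eq A α ht).symm
  · rw [h.eq_riccati ht, M.predVar_eq A α ht]
  · rw [h.cost_eq ht, M.filtVar_eq A α ht]
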